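/- Let $\alpha_1,\beta_0\in\mathbb{R}$, put $p=-\tfrac12(\alpha_1+\beta_0)$ and $q=-\tfrac12(\alpha_1-\beta_0)$, and assume $-1<p<0$, $-1<q<0$ and $-2<p+q<-1$. Let $\gamma=\beta_0-\alpha_1$, $\varepsilon_n=(-1)^n$, $s=0$, $r=-1$, and let $\{P_n\}_{n\ge0}$ be the monic polynomials defined by $$P_0=1,\quad P_1=x-\beta_0,\quad P_2=(x-\beta_1)P_1-\alpha_1,\quad P_{n+3}=(x-\beta_{n+2})P_{n+2}-\alpha_{n+2}P_{n+1}-\gamma_{n+1}P_n\quad(n\ge0),$$ where, for $n\ge0$, $$\beta_n=(\varepsilon_nr-2s)n-\tfrac12(1-\varepsilon_n)r+\beta_0,\qquad \alpha_{n+1}=(n+1)\big[(r^2+s^2)n+(1-\varepsilon_n)rs+\alpha_1\big],$$ $$\gamma_{n+1}=(n+2)(n+1)\big[\varepsilon_n(r-\varepsilon_ns)^2rn-\tfrac12(1-\varepsilon_n)\big((r+s)^2+2\alpha_1\big)r+\gamma\big].$$ Let $\{u_n\}_{n\ge0}$ be the dual sequence of $\{P_n\}$, i.e. the linear functionals on the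 space of polynomials with complex coefficients with $\langle u_n,P_m\rangle=\delta_{nm}$ for all $n,m\ge 0$. For $x>0$ let $U(a;c;x)$ be the Tricomi function, i.e. the solution of Kummer's equation $xy''+(c-x)y'-ay=0$ on $(0,\infty)$ with $U(a;c;x)\sim x^{-a}$ as $x\to+\infty$; the value at $x=0$ is the limit as $x\to0^+$ when it exists. Put $$\mathscr{U}(x;p,q)=e^{-x}U(1+p;2+p+q;2x)\ \ (x\ge0),\qquad \mathscr{V}(x;q,p)=e^{x}U(1+q;2+p+q;-2x)\ \ (x\le0),$$ $$\Delta(p,q)=\Gamma(-p-q)\Big[p\,{}_2F_1(1,1+p;1-q;-1)+q\,{}_2F_1(1,1+q;1-p;-1)\Big].$$ Then $\Delta(p,q)\ne0$, and with $$k_1=\frac{p\,\Gamma(1-q)}{\Delta(p,q)},\quad k_2=\frac{q\,\Gamma(1-p)}{\Delta(p,q)},\quad \tilde k_1=-\frac{q\,\Gamma(-q)}{2\Delta(p,q)},\quad \tilde k_2=-\frac{q\,\Gamma(-p)}{2\Delta(p,q)}$$ the formulas $$w_0(x)=\begin{cases}k_1\,\mathscr{U}(x;p,q),&x\ge0,\\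 k_2\,\mathscr{V}(x;q,p),&x\le0,\end{cases}$$ $$w_1(x)=\begin{cases}\tilde k_1\big[(1+\beta_0)\mathscr{U}(x;p,q)-2x\,\mathscr{U}(x;p,1+q)\big],&x\ge0,\\ \tilde k_2\big[(1+\beta_0-2x)\mathscr{V}(x;q,p)+2x\,\mathscr{V}(x;q,1+p)\big],&x\le0,\end{cases}$$ agree at $x=0$ (where the terms with factor $2x$ are read as $0$, which is also their limit), so that they define functions $w_0,w_1$ on $\mathbb{R}$; these are continuous at $0$, and for every polynomial $f$ the functions $fw_0$ and $fw_1$ are integrable on $\mathbb{R}$ with $$\langle u_0,f\rangle=\int_{-\infty}^{+\infty}f(x)w_0(x)\,dx,\qquad \langle u_1,f\rangle=\int_{-\infty}^{+\infty}f(x)w_1(x)\,dx .$$ -/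

import Mathlib

open Polynomial Filter Topology Asymptotics MeasureTheory

/-! ### The recurrence coefficients and the polynomials -/

/-- The sign `ε_n = (-1)^n`. -/
def epsSign (n : ℕ) : ℝ := (-1) ^ n

/-- The recurrence coefficient `β_n`. -/
noncomputable def betaCoeff (r s β₀ : ℝ) (n : ℕ) : ℝ :=
  (epsSign n * r - 2 * s) * n - (1 / 2) * (1 - epsSign n) * r + β₀

/-- The recurrence coefficient `α_{n+1}`; the argument is `n`. -/
noncomputable def alphaCoeffSucc (r s α₁ : ℝ) (n : ℕ) : ℝ :=
  (n + 1) * ((r ^ 2 + s ^ 2) * n + (1 - epsSign n) * r * s + α₁)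

/-- The recurrence coefficient `γ_{n+1}`; the argument is `n` (so `γ_1 = 2 γ`). -/
noncomputable def gammaCoeffSucc (r s α₁ γ : ℝ) (n : ℕ) : ℝ :=
  (n + 2) * (n + 1) *
    (epsSign n * (r - epsSign n * s) ^ 2 * r * n
      - (1 / 2) * (1 - epsSign n) * ((r + s) ^ 2 + 2 * α₁) * r + γ)

/-- The monic polynomials `P_n`, given by
`P_0 = 1`, `P_1 = x - β_0`, `P_2 = (x - β_1) P_1 - α_1`,
`P_{n+3} = (x - β_{n+2}) P_{n+2} - α_{n+2} P_{n+1} - γ_{n+1} P_n`. -/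
noncomputable def twoOPS (r s β₀ α₁ γ : ℝ) : ℕ → ℂ[X]
  | 0 => 1
  | 1 => X - C (β₀ : ℂ)
  | 2 => (X - C (betaCoeff r s β₀ 1 : ℂ)) * (X - C (β₀ : ℂ)) - C (α₁ : ℂ)
  | n + 3 =>
      (X - C (betaCoeff r s β₀ (n + 2) : ℂ)) * twoOPS r s β₀ α₁ γ (n + 2)
        - C (alphaCoeffSucc r s α₁ (n + 1) : ℂ) * twoOPS r s β₀ α₁ γ (n + 1)
        - C (gammaCoeffSucc r s α₁ γ n : ℂ) * twoOPS r s β₀ α₁ γ n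

/-- `u` is the dual sequence of the polynomial sequence `P`: `⟨u_n, P_m⟩ = δ_{nm}`. -/
def IsDualSequence (P : ℕ → ℂ[X]) (u : ℕ → Module.Dual ℂ ℂ[X]) : Prop :=
  ∀ n m : ℕ, u n (P m) = if n = m then 1 else 0

/-- The functional `v` has the integral representation `⟨v, f⟩ = ∫_ℝ f(x) w(x) dx` for every
polynomial `f`, all the integrals being absolutely convergent. -/
def HasIntegralRepresentation (v : Module.Dual ℂ ℂ[X]) (w : ℝ → ℝ) : Prop :=
  ∀ f : ℂ[X],
    Integrable (fun x : ℝ => f.eval (x : ℂ) * (w x : ℂ)) ∧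
      v f = ∫ x : ℝ, f.eval (x : ℂ) * (w x : ℂ)

/-! ### The Tricomi function -/

/-- `y` is a solution on `(0, ∞)` of Kummer's equation `x y'' + (c - x) y' - a y = 0` such that
`y(x) ∼ x^{-a}` as `x → +∞`. For each pair `(a, c)` there is exactly one such function on
`(0, ∞)`, since every solution independent of it grows like a constant times `e^x x^{a-c}`. -/
structure IsTricomiSolution (a c : ℝ) (y : ℝ → ℝ) : Prop where
  differentiableOn : DifferentiableOn ℝ y (Set.Ioi 0)
  differentiableOn_deriv : DifferentiableOn ℝ (deriv y) (Set.Ioi 0)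
  kummer : ∀ x : ℝ, 0 < x → x * deriv (deriv y) x + (c - x) * deriv y x - a * y x = 0
  isEquivalent : y ~[atTop] fun x : ℝ => x ^ (-a)

/-- The Tricomi function `U(a; c; x)` for real `a`, `c` and `x ≥ 0`: for `x > 0` it is the
solution of Kummer's equation singled out by `U(a; c; x) ∼ x^{-a}`, and for `x = 0` it is the
limit of `U(a; c; t)` as `t → 0⁺` whenever that limit exists (as it does for `c < 1`).
The values for `x < 0` have no meaning and are never used. -/
noncomputable def tricomiU (a c x : ℝ) : ℝ :=
  if 0 < x then Classical.epsilon (IsTricomiSolution a c) x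
  else limUnder (𝓝[>] (0 : ℝ)) (Classical.epsilon (IsTricomiSolution a c))

/-- The modified Tricomi function `𝒰(x; p, q) = e^{-x} U(1 + p; 2 + p + q; 2x)`, for `x ≥ 0`. -/
noncomputable def modTricomiU (x p q : ℝ) : ℝ :=
  Real.exp (-x) * tricomiU (1 + p) (2 + p + q) (2 * x)

/-- The modified Tricomi function `𝒱(x; q, p) = e^{x} U(1 + q; 2 + p + q; -2x)`, for `x ≤ 0`.
The order of the arguments is `x`, `q`, `p`. -/
noncomputable def modTricomiV (x q p : ℝ) : ℝ :=
  Real.exp x * tricomiU (1 + q) (2 + p + q) (-2 * x)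

/-! ### The normalising constant -/

/-- `Δ(p, q)`. The hypergeometric series at `-1` converge absolutely when `p + q < -1`. -/
noncomputable def deltaConst (p q : ℝ) : ℝ :=
  Real.Gamma (-p - q) *
    (p * ₂F₁ (1 : ℝ) (1 + p) (1 - q) (-1 : ℝ) + q * ₂F₁ (1 : ℝ) (1 + q) (1 - p) (-1 : ℝ))

/-! Encode a functional by the exponential generating function of its moments, formally `⟨v,
e^{xz}⟩`; multiplication by `x` becomes `d/dz`. For `r = -1`, `s = 0` the coefficients reduce to
`α_{n+1} = (n+1)(n-(p+q))` and `γ_{n+1} = (n+2)(n+1) g_n`, and the generating function of `u_0` is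
`F = (1-z)^p (1+z)^q`, characterised by `F(0) = 1` and `(1-z²)F' = ((q-p)-(p+q)z)F`. That of `n!
u_n` is `z^n (1-z)^{-⌈n/2⌉} (1+z)^{-⌊n/2⌋} F`: these series satisfy the transpose of the recurrence
for `P_n` (`derivative_dualEgf`), which forces duality (`egfFunctional_dualEgf_twoOPS`). Thus a
sequence `M` is the moment sequence of `u_0` as soon as it starts from `M_0 = 1` and satisfies the
recurrence read off the differential equation, and the moments of `u_1` are then explicit in `M`
(`dualSequence_moments`).

It remains to compute moments of the weights. The Tricomi function equals its Laplace integral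
(`isTricomiSolution_tricomiIntegral`, with uniqueness from a Wronskian argument), so by Fubini the
moments of `𝒰` on the half-line are `n!/Γ(1+p)` times `∫ t^p (1+t)^q (1+2t)^{-(n+1)} dt`.
Integrating an exact derivative gives a three-term recurrence in the last exponent
(`eulerIntegral_recurrence`), hence the recurrence for `M_{n+2}`, on each half-line separately. In
the relation for `M_1` the values at `0` enter, and they cancel because the two halves of `w_0`
match there. Finally `M_0 = 1` is the choice of `Δ`, the integrals with `n = 0` being hypergeometric
values at `-1` (`eulerIntegral_one_eq`). The left half-line is the right one reflected, with `p` and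
`q` exchanged. -/

/-! ### Linear functionals on polynomials and their exponential generating functions -/

/-- The linear functional on polynomials whose `n`-th moment is `n!` times the `n`-th coefficient
of the power series `H`. -/
noncomputable def egfFunctional (H : PowerSeries ℂ) : Module.Dual ℂ ℂ[X] :=
  (Polynomial.basisMonomials ℂ).constr ℂ fun n => (n.factorial : ℂ) * PowerSeries.coeff n H

lemma egfFunctional_X_pow (H : PowerSeries ℂ) (n : ℕ) :
    egfFunctional H (X ^ n) = (n.factorial : ℂ) * PowerSeries.coeff n H := by
  have : egfFunctional H (Polynomial.basisMonomials ℂ n)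
      = (n.factorial : ℂ) * PowerSeries.coeff n H :=
    (Polynomial.basisMonomials ℂ).constr_basis ℂ _ n
  simpa [coe_basisMonomials, monomial_one_right_eq_X_pow] using this

lemma dual_ext_X_pow {v w : Module.Dual ℂ ℂ[X]} (h : ∀ n, v (X ^ n) = w (X ^ n)) : v = w := by
  refine (Polynomial.basisMonomials ℂ).ext fun n => ?_
  simpa [coe_basisMonomials, monomial_one_right_eq_X_pow] using h n

lemma egfFunctional_add (G H : PowerSeries ℂ) :
    egfFunctional (G + H) = egfFunctional G + egfFunctional H :=
  dual_ext_X_pow fun n => by simp [egfFunctional_X_pow, mul_add]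

lemma egfFunctional_C_mul (c : ℂ) (H : PowerSeries ℂ) :
    egfFunctional (PowerSeries.C c * H) = c • egfFunctional H :=
  dual_ext_X_pow fun n => by simp [egfFunctional_X_pow, mul_left_comm]

/-- The coefficient of index `n` of the derivative is `(n+1) h_{n+1}`, and `n! (n+1) = (n+1)!`, so
the moments are shifted by one. -/
lemma egfFunctional_derivative (H : PowerSeries ℂ) (f : ℂ[X]) :
    egfFunctional (PowerSeries.derivative ℂ H) f = egfFunctional H (X * f) := by
  have : egfFunctional (PowerSeries.derivative ℂ H)
      = egfFunctional H ∘ₗ LinearMap.mulLeft ℂ (X : ℂ[X]) :=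
    dual_ext_X_pow fun n => by
      rw [LinearMap.comp_apply, LinearMap.mulLeft_apply, ← pow_succ', egfFunctional_X_pow,
        egfFunctional_X_pow, PowerSeries.coeff_derivative, Nat.factorial_succ]
      push_cast
      ring
  rw [this]
  rfl

/-! ### The generating functions of the dual sequence -/

/-- The power series `X ^ n (1 - X)^{-⌈n/2⌉} (1 + X)^{-⌊n/2⌋} F`. -/
noncomputable def dualEgf (F : PowerSeries ℂ) (n : ℕ) : PowerSeries ℂ :=
  PowerSeries.X ^ n * ((1 - PowerSeries.X)⁻¹) ^ ((n + 1) / 2) * ((1 + PowerSeries.X)⁻¹) ^ (n / 2) * F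

/-- The factor `g_n` in `γ_{n+1} = (n + 2) (n + 1) g_n`. -/
noncomputable def gammaFactor (p q : ℝ) (n : ℕ) : ℝ :=
  if Even n then 2 * q - n else n + 1 - 2 * p

lemma alphaCoeffSucc_eq (α₁ : ℝ) (n : ℕ) :
    alphaCoeffSucc (-1) 0 α₁ n = (n + 1) * (n + α₁) := by
  simp [alphaCoeffSucc]

lemma gammaCoeffSucc_eq (p q : ℝ) (n : ℕ) :
    gammaCoeffSucc (-1) 0 (-(p + q)) (2 * q) n = (n + 2) * (n + 1) * gammaFactor p q n := by
  rcases Nat.even_or_odd n with h | h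
  · simp only [gammaCoeffSucc, gammaFactor, epsSign, h, Even.neg_one_pow, if_true]; ring
  · simp only [gammaCoeffSucc, gammaFactor, epsSign, h, Odd.neg_one_pow, Nat.not_even_iff_odd.2 h,
      if_false]
    ring

/-- This is the transposed recurrence for `n! u_n`. The hypothesis says `F'/F = q/(1+X) - p/(1-X)`,
so the logarithmic derivative of the series is explicit, and partial fractions turn the result into
a combination of its neighbours. At `n = 0` the truncated index `n - 1` is harmless, its coefficient
being `0`. -/
lemma derivative_dualEgf (p q : ℝ) (F : PowerSeries ℂ)
    (hF : (1 - PowerSeries.X ^ 2) * PowerSeries.derivative ℂ F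
      = (PowerSeries.C ((q : ℂ) - p) - PowerSeries.C ((p : ℂ) + q) * PowerSeries.X) * F) (n : ℕ) :
    PowerSeries.derivative ℂ (dualEgf F n)
      = PowerSeries.C (n : ℂ) * dualEgf F (n - 1)
        + PowerSeries.C (betaCoeff (-1) 0 (q - p) n : ℂ) * dualEgf F n
        + PowerSeries.C ((n : ℂ) - (p + q)) * dualEgf F (n + 1)
        + PowerSeries.C (gammaFactor p q n : ℂ) * dualEgf F (n + 2) := by
  set Y : PowerSeries ℂ := PowerSeries.X with hY
  set A : PowerSeries ℂ := (1 - Y)⁻¹ with hA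
  set B : PowerSeries ℂ := (1 + Y)⁻¹ with hB
  set P : PowerSeries ℂ := PowerSeries.C (p : ℂ)
  set Q : PowerSeries ℂ := PowerSeries.C (q : ℂ)
  set D := PowerSeries.derivative ℂ
  -- The relations for `Y * A` and `Y * B` suffice to reduce all products of `Y`, `A`, `B` that
  -- occur; the rest is linear algebra over them.
  have hA1 : Y * A = A - 1 := by
    have : (1 - Y) * A = 1 := PowerSeries.mul_inv_cancel _ (by simp [Y])
    linear_combination -this
  have hB1 : Y * B = 1 - B := by
    have : (1 + Y) * B = 1 := PowerSeries.mul_inv_cancel _ (by simp [Y])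
    linear_combination this
  have hAB : 2 * (A * B) = A + B := by linear_combination (-B) * hA1 + A * hB1
  have hDA : D A = A ^ 2 := by
    simp [D, hA, PowerSeries.derivative_inv', hY]
  have hDB : D B = -B ^ 2 := by
    simp [D, hB, PowerSeries.derivative_inv', hY]
  have hDF : D F = (Q * B - P * A) * F := by
    have h1 : (A * B) * ((1 - Y ^ 2) * D F) = D F := by
      linear_combination (- (1 + Y) * B * D F) * hA1 + D F * hB1
    rw [hF] at h1
    simp only [map_sub, map_add] at h1
    rw [← h1]
    linear_combination (-P * B - Q * B) * F * hA1 - P * F * hAB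
  have hDY : D Y = 1 := PowerSeries.derivative_X
  have hDApow (i : ℕ) : D (A ^ i) = i * A ^ i * A := by
    rcases i with _ | i
    · simp
    · rw [Derivation.leibniz_pow, hDA]; simp; ring
  have hDBpow (i : ℕ) : D (B ^ i) = -(i * B ^ i * B) := by
    rcases i with _ | i
    · simp
    · rw [Derivation.leibniz_pow, hDB]; simp; ring
  have hD (n i j : ℕ) : D (Y ^ n * A ^ i * B ^ j * F) = n * Y ^ (n - 1) * A ^ i * B ^ j * F
      + Y ^ n * A ^ i * B ^ j * F * (i * A - j * B + Q * B - P * A) := by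
    simp only [Derivation.leibniz, hDApow, hDBpow, hDF, hDY, smul_eq_mul, Derivation.leibniz_pow,
      nsmul_eq_mul]
    ring
  have hYAB : Y ^ 2 * (A * B) * 2 = A + B - 2 := by
    linear_combination (2 * Y * B) * hA1 + 2 * A * hB1 - 2 * hB1 - hAB
  rcases Nat.even_or_odd' n with ⟨k, rfl | rfl⟩
  · have hβ : betaCoeff (-1) 0 (q - p) (2 * k) = -(2 * k) + (q - p) := by
      simp [betaCoeff, epsSign]
    have hg : gammaFactor p q (2 * k) = 2 * q - 2 * k := by simp [gammaFactor]
    have e1 : dualEgf F (2 * k) = Y ^ (2 * k) * A ^ k * B ^ k * F := by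
      simp [dualEgf, Y, A, B, show (2 * k + 1) / 2 = k by omega]
    have e2 : dualEgf F (2 * k + 1) = Y ^ (2 * k + 1) * A ^ (k + 1) * B ^ k * F := by
      simp [dualEgf, Y, A, B, show (2 * k + 1 + 1) / 2 = k + 1 by omega,
        show (2 * k + 1) / 2 = k by omega]
    have e3 : dualEgf F (2 * k + 2) = Y ^ (2 * k + 2) * A ^ (k + 1) * B ^ (k + 1) * F := by
      simp [dualEgf, Y, A, B, show (2 * k + 2 + 1) / 2 = k + 1 by omega]
    -- The factor `B ^ k` has one power too many for index `2k - 1`; it is removed with `B = 1 - Y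
    -- B`. The case `k = 0` is separate because of truncated subtraction.
    have e4 : ((2 * k : ℕ) : PowerSeries ℂ) * Y ^ (2 * k - 1) * A ^ k * B ^ k * F
        = (2 * k : ℕ) * dualEgf F (2 * k - 1) - (2 * k : ℕ) * dualEgf F (2 * k) := by
      rcases k with _ | k
      · simp
      · have e5 : dualEgf F (2 * (k + 1) - 1) = Y ^ (2 * k + 1) * A ^ (k + 1) * B ^ k * F := by
          simp [dualEgf, Y, A, B, show 2 * (k + 1) - 1 = 2 * k + 1 by omega,
            show (2 * k + 1 + 1) / 2 = k + 1 by omega, show (2 * k + 1) / 2 = k by omega]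
        rw [e5, e1, show 2 * (k + 1) - 1 = 2 * k + 1 by omega]
        linear_combination ((2 * (k + 1) : ℕ) : PowerSeries ℂ) * Y ^ (2 * k + 1) * A ^ (k + 1)
          * B ^ k * F * hB1
    rw [hβ, hg, e1, hD, e4, e1, e2, e3]
    push_cast
    simp only [map_sub, map_add, map_neg, map_mul, map_natCast, map_ofNat]
    linear_combination (-1 : PowerSeries ℂ) * (Y ^ (2 * k) * A ^ k * B ^ k * F) *
      ((2 * k - P - Q) * hA1 + (Q - k) * hYAB)
  · have hβ : betaCoeff (-1) 0 (q - p) (2 * k + 1) = (2 * k + 1) + 1 + (q - p) := by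
      simp [betaCoeff, epsSign, pow_succ]; ring
    have hg : gammaFactor p q (2 * k + 1) = 2 * k + 1 + 1 - 2 * p := by simp [gammaFactor]
    have e1 : dualEgf F (2 * k) = Y ^ (2 * k) * A ^ k * B ^ k * F := by
      simp [dualEgf, Y, A, B, show (2 * k + 1) / 2 = k by omega]
    have e2 : dualEgf F (2 * k + 1) = Y ^ (2 * k + 1) * A ^ (k + 1) * B ^ k * F := by
      simp [dualEgf, Y, A, B, show (2 * k + 1 + 1) / 2 = k + 1 by omega,
        show (2 * k + 1) / 2 = k by omega]
    have e3 : dualEgf F (2 * k + 1 + 1) = Y ^ (2 * k + 2) * A ^ (k + 1) * B ^ (k + 1) * F := by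
      simp [dualEgf, Y, A, B, show (2 * k + 1 + 1 + 1) / 2 = k + 1 by omega,
        show (2 * k + 1 + 1) / 2 = k + 1 by omega]
    have e4 : dualEgf F (2 * k + 1 + 2) = Y ^ (2 * k + 3) * A ^ (k + 2) * B ^ (k + 1) * F := by
      simp [dualEgf, Y, A, B, show (2 * k + 1 + 2 + 1) / 2 = k + 2 by omega,
        show (2 * k + 1 + 2) / 2 = k + 1 by omega]
    rw [hβ, hg, e2, hD, e3, e4, show 2 * k + 1 - 1 = 2 * k by omega, e1]
    push_cast
    simp only [map_sub, map_add, map_mul, map_natCast, map_ofNat, map_one]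
    linear_combination (-1 : PowerSeries ℂ) * (Y ^ (2 * k + 1) * A ^ (k + 1) * B ^ k * F) *
      ((2 * k + 1 - P - Q) * hB1 + (k + 1 - P) * hYAB)
        - (2 * k + 1 : PowerSeries ℂ) * Y ^ (2 * k) * A ^ k * B ^ k * F * hA1

lemma egfFunctional_dualEgf_X_mul (p q : ℝ) (F : PowerSeries ℂ)
    (hF : (1 - PowerSeries.X ^ 2) * PowerSeries.derivative ℂ F
      = (PowerSeries.C ((q : ℂ) - p) - PowerSeries.C ((p : ℂ) + q) * PowerSeries.X) * F)
    (n : ℕ) (f : ℂ[X]) :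
    egfFunctional (dualEgf F n) (X * f)
      = n * egfFunctional (dualEgf F (n - 1)) f
        + (betaCoeff (-1) 0 (q - p) n : ℂ) * egfFunctional (dualEgf F n) f
        + ((n : ℂ) - (p + q)) * egfFunctional (dualEgf F (n + 1)) f
        + (gammaFactor p q n : ℂ) * egfFunctional (dualEgf F (n + 2)) f := by
  rw [← egfFunctional_derivative, derivative_dualEgf p q F hF]
  simp only [egfFunctional_add, egfFunctional_C_mul, LinearMap.add_apply, LinearMap.smul_apply,
    smul_eq_mul]

lemma egfFunctional_dualEgf_one (F : PowerSeries ℂ) (hF0 : PowerSeries.coeff 0 F = 1) (n : ℕ) :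
    egfFunctional (dualEgf F n) 1 = if n = 0 then 1 else 0 := by
  have := egfFunctional_X_pow (dualEgf F n) 0
  rw [pow_zero] at this
  rw [this]
  rw [PowerSeries.coeff_zero_eq_constantCoeff_apply] at hF0 ⊢
  rcases n with _ | n
  · simp [dualEgf, hF0]
  · simp [dualEgf]

/-- Induction on `m`: the recurrence trades `P_m` for `X` times its predecessor, and `X` is moved
onto the functional. What remains is a relation between Kronecker deltas and factorials. -/
lemma egfFunctional_dualEgf_twoOPS (p q : ℝ) (F : PowerSeries ℂ)
    (hF0 : PowerSeries.coeff 0 F = 1)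
    (hF : (1 - PowerSeries.X ^ 2) * PowerSeries.derivative ℂ F
      = (PowerSeries.C ((q : ℂ) - p) - PowerSeries.C ((p : ℂ) + q) * PowerSeries.X) * F)
    (m n : ℕ) :
    egfFunctional (dualEgf F n) (twoOPS (-1) 0 (q - p) (-(p + q)) (2 * q) m)
      = if n = m then (n.factorial : ℂ) else 0 := by
  induction m using Nat.strong_induction_on generalizing n with
  | _ m ih =>
  have hC (H : PowerSeries ℂ) (c : ℂ) (f : ℂ[X]) :
      egfFunctional H (C c * f) = c * egfFunctional H f := by
    rw [← smul_eq_C_mul, map_smul, smul_eq_mul]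
  have h0 := egfFunctional_dualEgf_one F hF0
  have hX := egfFunctional_dualEgf_X_mul p q F hF
  match m, ih with
  | 0, _ =>
    rw [twoOPS, h0]
    rcases n with _ | n <;> simp
  | 1, ih =>
    have h1 : twoOPS (-1) 0 (q - p) (-(p + q)) (2 * q) 1
        = X * 1 - C ((q - p : ℝ) : ℂ) * 1 := by rw [twoOPS]; ring
    rw [h1, map_sub, hX, hC]
    simp only [h0]
    rcases n with _ | _ | n <;> simp [betaCoeff, epsSign]
  | 2, ih =>
    have h2 : twoOPS (-1) 0 (q - p) (-(p + q)) (2 * q) 2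
        = X * twoOPS (-1) 0 (q - p) (-(p + q)) (2 * q) 1
          - C (betaCoeff (-1) 0 (q - p) 1 : ℂ) * twoOPS (-1) 0 (q - p) (-(p + q)) (2 * q) 1
          - C ((-(p + q) : ℝ) : ℂ) * twoOPS (-1) 0 (q - p) (-(p + q)) (2 * q) 0 := by
      rw [twoOPS, twoOPS, twoOPS]; ring
    rw [h2, map_sub, map_sub, hX, hC, hC]
    simp only [ih 1 (by norm_num), ih 0 (by norm_num)]
    rcases n with _ | _ | _ | n <;> simp
  | m + 3, ih =>
    have h3 : twoOPS (-1) 0 (q - p) (-(p + q)) (2 * q) (m + 3)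
        = X * twoOPS (-1) 0 (q - p) (-(p + q)) (2 * q) (m + 2)
          - C (betaCoeff (-1) 0 (q - p) (m + 2) : ℂ) *
              twoOPS (-1) 0 (q - p) (-(p + q)) (2 * q) (m + 2)
          - C (alphaCoeffSucc (-1) 0 (-(p + q)) (m + 1) : ℂ) *
              twoOPS (-1) 0 (q - p) (-(p + q)) (2 * q) (m + 1)
          - C (gammaCoeffSucc (-1) 0 (-(p + q)) (2 * q) m : ℂ) *
              twoOPS (-1) 0 (q - p) (-(p + q)) (2 * q) m := by
      rw [twoOPS]; ring
    rw [h3, map_sub, map_sub, map_sub, hX, hC, hC, hC, alphaCoeffSucc_eq, gammaCoeffSucc_eq]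
    simp only [ih (m + 2) (by omega), ih (m + 1) (by omega), ih m (by omega)]
    have key : n = m ∨ n = m + 1 ∨ n = m + 2 ∨ n = m + 3 ∨
        (n ≠ m ∧ n ≠ m + 1 ∧ n ≠ m + 2 ∧ n ≠ m + 3 ∧ n - 1 ≠ m + 2) := by omega
    rcases key with rfl | rfl | rfl | rfl | ⟨g1, g2, g3, g4, g5⟩
    · rw [if_neg (by omega : n - 1 ≠ n + 2)]
      simp [Nat.factorial_succ]
      ring
    · simp [Nat.factorial_succ]
      ring
    · simp [Nat.factorial_succ]
    · simp [Nat.factorial_succ]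
      left
      ring
    · simp [g1, g2, g3, g4, g5]

/-! ### Uniqueness of the dual sequence -/

lemma degree_twoOPS (r s β₀ α₁ γ : ℝ) (n : ℕ) :
    (twoOPS r s β₀ α₁ γ n).degree = n := by
  have hmul (b : ℂ) (f : ℂ[X]) (k : ℕ) (hf : f.degree = k) :
      ((X - C b) * f).degree = ((k + 1 : ℕ) : WithBot ℕ) := by
    rw [degree_mul, degree_X_sub_C, hf, add_comm]; rfl
  have hCmul (c : ℂ) (f : ℂ[X]) (k l : ℕ) (hf : f.degree = k) (hl : k < l) :
      (C c * f).degree < (l : WithBot ℕ) := by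
    refine lt_of_le_of_lt ?_ (Nat.cast_lt.2 hl)
    rw [← hf, ← smul_eq_C_mul]
    exact degree_smul_le c f
  induction n using Nat.strong_induction_on with
  | _ n ih =>
  match n, ih with
  | 0, _ => rw [twoOPS]; simp
  | 1, _ => rw [twoOPS]; exact degree_X_sub_C _
  | 2, ih =>
    have h1 := hmul (betaCoeff r s β₀ 1 : ℂ) (X - C (β₀ : ℂ)) 1 (degree_X_sub_C _)
    rw [twoOPS, degree_sub_eq_left_of_degree_lt, h1]
    rw [h1]
    exact lt_of_le_of_lt degree_C_le (by norm_num)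
  | n + 3, ih =>
    have h1 := hmul (betaCoeff r s β₀ (n + 2) : ℂ) _ _ (ih (n + 2) (by omega))
    have h2 := hCmul (alphaCoeffSucc r s α₁ (n + 1) : ℂ) _ _ (n + 3) (ih (n + 1) (by omega))
      (by omega)
    have h3 := hCmul (gammaCoeffSucc r s α₁ γ n : ℂ) _ _ (n + 3) (ih n (by omega)) (by omega)
    rw [twoOPS, degree_sub_eq_left_of_degree_lt, degree_sub_eq_left_of_degree_lt, h1]
    · rw [h1]; exact h2
    · rw [degree_sub_eq_left_of_degree_lt, h1]
      · exact h3
      · rw [h1]; exact h2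

lemma dual_ext_twoOPS {r s β₀ α₁ γ : ℝ} {v w : Module.Dual ℂ ℂ[X]}
    (h : ∀ n, v (twoOPS r s β₀ α₁ γ n) = w (twoOPS r s β₀ α₁ γ n)) : v = w := by
  let S : Polynomial.Sequence ℂ := ⟨twoOPS r s β₀ α₁ γ, degree_twoOPS r s β₀ α₁ γ⟩
  refine LinearMap.ext_on_range
    (S.span fun i => (leadingCoeff_ne_zero.2 (S.ne_zero i)).isUnit) h

lemma dualSequence_eq_egfFunctional (p q : ℝ) (F : PowerSeries ℂ)
    (hF0 : PowerSeries.coeff 0 F = 1)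
    (hF : (1 - PowerSeries.X ^ 2) * PowerSeries.derivative ℂ F
      = (PowerSeries.C ((q : ℂ) - p) - PowerSeries.C ((p : ℂ) + q) * PowerSeries.X) * F)
    {u : ℕ → Module.Dual ℂ ℂ[X]}
    (hu : IsDualSequence (twoOPS (-1) 0 (q - p) (-(p + q)) (2 * q)) u) {n : ℕ} (hn : n ≤ 1) :
    u n = egfFunctional (dualEgf F n) := by
  refine dual_ext_twoOPS fun m => (hu n m).trans ?_
  rw [egfFunctional_dualEgf_twoOPS p q F hF0 hF, Nat.factorial_eq_one.2 hn, Nat.cast_one]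

/-- Coefficientwise, the differential equation for `F` is exactly the recurrence on `M`. For `u 1`,
the series `X (1 - X)⁻¹ F` is linear in `F` and `F'`. -/
lemma dualSequence_moments (p q : ℝ) (hp : p ≠ 0) (M : ℕ → ℂ) (hM0 : M 0 = 1)
    (hM1 : M 1 = (q - p) * M 0)
    (hM : ∀ n : ℕ, M (n + 2) = (q - p) * M (n + 1) + (n + 1) * (n - (p + q)) * M n)
    {u : ℕ → Module.Dual ℂ ℂ[X]}
    (hu : IsDualSequence (twoOPS (-1) 0 (q - p) (-(p + q)) (2 * q)) u) (n : ℕ) :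
    u 0 (X ^ n) = M n ∧
      u 1 (X ^ n) = 1 / (2 * p) * ((q - p - n) * M n - M (n + 1)) := by
  set F : PowerSeries ℂ := PowerSeries.mk fun n => M n / n.factorial
  have hfac (n : ℕ) : (n.factorial : ℂ) ≠ 0 := by exact_mod_cast n.factorial_ne_zero
  have hc (n : ℕ) : PowerSeries.coeff n F = M n / n.factorial := by simp [F]
  have hF0 : PowerSeries.coeff 0 F = 1 := by rw [hc, hM0]; simp
  have hD (n : ℕ) : PowerSeries.coeff n (PowerSeries.derivative ℂ F) = M (n + 1) / n.factorial := by
    have : (n : ℂ) + 1 ≠ 0 := by exact_mod_cast n.succ_ne_zero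
    rw [PowerSeries.coeff_derivative, hc, Nat.factorial_succ]
    have := hfac n
    push_cast
    field_simp
  have hF : (1 - PowerSeries.X ^ 2) * PowerSeries.derivative ℂ F
      = (PowerSeries.C ((q : ℂ) - p) - PowerSeries.C ((p : ℂ) + q) * PowerSeries.X) * F := by
    ext n
    rw [sub_mul, one_mul, sub_mul, mul_assoc, map_sub, map_sub, PowerSeries.coeff_C_mul,
      PowerSeries.coeff_C_mul, hD, hc]
    rcases n with _ | _ | n
    · simp [hM1]
    · rw [PowerSeries.coeff_succ_X_mul, hc, PowerSeries.coeff_X_pow_mul']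
      simp only [zero_add, hM 0]
      simp
      ring
    · rw [PowerSeries.coeff_succ_X_mul, hc, show n + 1 + 1 = n + 2 from rfl,
        PowerSeries.coeff_X_pow_mul, hD]
      have h1 : (n : ℂ) + 1 ≠ 0 := by exact_mod_cast n.succ_ne_zero
      have h2 : (n : ℂ) + 1 + 1 ≠ 0 := by exact_mod_cast (n + 1).succ_ne_zero
      have := hfac n
      rw [hM (n + 1), Nat.factorial_succ (n + 1), Nat.factorial_succ n]
      push_cast
      field_simp
      ring
  have hM' : egfFunctional F (X ^ n) = M n := by
    rw [egfFunctional_X_pow, hc, mul_div_cancel₀ _ (hfac n)]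
  refine ⟨?_, ?_⟩
  · rw [dualSequence_eq_egfFunctional p q F hF0 hF hu zero_le_one]
    simpa [dualEgf] using hM'
  · rw [dualSequence_eq_egfFunctional p q F hF0 hF hu le_rfl]
    have hp' : (p : ℂ) ≠ 0 := by exact_mod_cast hp
    have hA : (1 - PowerSeries.X) * (1 - PowerSeries.X : PowerSeries ℂ)⁻¹ = 1 :=
      PowerSeries.mul_inv_cancel _ (by simp)
    -- With `F'/F = q/(1+X) - p/(1-X)`, the right side is `p ((1+X)/(1-X) - 1) F`.
    have h1 : PowerSeries.C (2 * p : ℂ) * dualEgf F 1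
        = PowerSeries.C ((q : ℂ) - p) * F - PowerSeries.derivative ℂ F
          - PowerSeries.X * PowerSeries.derivative ℂ F := by
      simp only [dualEgf, map_sub, map_add, map_mul, map_ofNat] at hF ⊢
      norm_num
      linear_combination (1 - PowerSeries.X : PowerSeries ℂ)⁻¹ * hF
        - (PowerSeries.derivative ℂ F + PowerSeries.X * PowerSeries.derivative ℂ F
          - (PowerSeries.C (q : ℂ) - PowerSeries.C (p : ℂ)) * F) * hA
    have h2 : (n.factorial : ℂ) * PowerSeries.coeff n (PowerSeries.X * PowerSeries.derivative ℂ F)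
        = n * M n := by
      rcases n with _ | n
      · simp
      · have := hfac n
        rw [PowerSeries.coeff_succ_X_mul, hD, Nat.factorial_succ]
        push_cast
        field_simp
    have h3 := congrArg (fun G => (n.factorial : ℂ) * PowerSeries.coeff n G) h1
    beta_reduce at h3
    rw [map_sub, map_sub, PowerSeries.coeff_C_mul, PowerSeries.coeff_C_mul, mul_sub, mul_sub, h2,
      hc, hD] at h3
    rw [egfFunctional_X_pow]
    have := hfac n
    field_simp at h3 ⊢
    linear_combination h3

/-! ### Integrals of `t ^ (a - 1) (1 + t) ^ b` with exponential and rational factors -/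

/-- The integrand `e^{-xt} t^{a-1} (1+t)^b`. -/
noncomputable def tricomiKernel (a b x t : ℝ) : ℝ :=
  Real.exp (-(x * t)) * (t ^ (a - 1) * (1 + t) ^ b)

/-- The integral `∫_0^∞ e^{-xt} t^{a-1} (1+t)^b dt`. -/
noncomputable def tricomiIntegral (a b x : ℝ) : ℝ :=
  ∫ t in Set.Ioi (0 : ℝ), tricomiKernel a b x t

lemma continuousOn_beta_kernel (a b : ℝ) :
    ContinuousOn (fun t : ℝ => t ^ (a - 1) * (1 + t) ^ b) (Set.Ioi 0) := by
  refine ContinuousOn.mul ?_ ?_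
  · exact fun t ht => (Real.continuousAt_rpow_const _ _ (Or.inl (ne_of_gt ht))).continuousWithinAt
  · intro t ht
    have ht : 0 < t := ht
    have : ContinuousAt (fun s : ℝ => (1 + s) ^ b) t :=
      ContinuousAt.rpow_const (by fun_prop) (Or.inl (by positivity))
    exact this.continuousWithinAt

lemma continuousOn_tricomiKernel (a b x : ℝ) :
    ContinuousOn (tricomiKernel a b x) (Set.Ioi 0) :=
  ContinuousOn.mul (by fun_prop) (continuousOn_beta_kernel a b)

lemma integrableOn_beta_kernel {a b : ℝ} (ha : 0 < a) (hab : a + b < 0) :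
    IntegrableOn (fun t : ℝ => t ^ (a - 1) * (1 + t) ^ b) (Set.Ioi 0) := by
  rw [← Set.Ioc_union_Ioi_eq_Ioi (zero_le_one (α := ℝ))]
  refine IntegrableOn.union ?_ ?_
  · rw [← integrableOn_Icc_iff_integrableOn_Ioc]
    refine IntegrableOn.mul_continuousOn ?_ ?_ isCompact_Icc
    · rw [integrableOn_Icc_iff_integrableOn_Ioc,
        ← intervalIntegrable_iff_integrableOn_Ioc_of_le zero_le_one]
      exact intervalIntegral.intervalIntegrable_rpow' (by linarith)
    · intro t ht
      have : ContinuousAt (fun s : ℝ => (1 + s) ^ b) t :=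
        ContinuousAt.rpow_const (by fun_prop) (Or.inl (by linarith [ht.1]))
      exact this.continuousWithinAt
  · have hint : IntegrableOn (fun t : ℝ => (2 : ℝ) ^ |b| * t ^ (a + b - 1)) (Set.Ioi 1) :=
      (integrableOn_Ioi_rpow_of_lt (by linarith) one_pos).const_mul _
    refine Integrable.mono' hint
      (((continuousOn_beta_kernel a b).mono
        (Set.Ioi_subset_Ioi zero_le_one)).aestronglyMeasurable measurableSet_Ioi) ?_
    refine (ae_restrict_iff' measurableSet_Ioi).2 (Eventually.of_forall fun t ht => ?_)
    have ht1 : (1 : ℝ) < t := ht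
    have ht0 : 0 < t := by linarith
    -- For `t > 1` the ratio `(1+t)/t` lies in `[1, 2]`, so its power `b` is at most `2 ^ |b|`
    -- whatever the sign of `b`.
    have h1 : (1 : ℝ) ≤ (1 + t) / t := by rw [le_div_iff₀ ht0]; linarith
    have h2 : (1 + t) / t ≤ 2 := by rw [div_le_iff₀ ht0]; linarith
    have h3 : (1 + t) ^ b = t ^ b * ((1 + t) / t) ^ b := by
      rw [← Real.mul_rpow ht0.le (by positivity), mul_div_cancel₀ _ ht0.ne']
    have h4 : ((1 + t) / t) ^ b ≤ 2 ^ |b| :=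
      (Real.rpow_le_rpow_of_exponent_le h1 (le_abs_self b)).trans
        (Real.rpow_le_rpow (by positivity) h2 (abs_nonneg b))
    rw [Real.norm_of_nonneg (by positivity), h3, show a + b - 1 = (a - 1) + b by ring,
      Real.rpow_add ht0]
    calc t ^ (a - 1) * (t ^ b * ((1 + t) / t) ^ b) ≤ t ^ (a - 1) * (t ^ b * 2 ^ |b|) := by gcongr
      _ = _ := by ring

lemma exists_exp_mul_pow_le {x : ℝ} (hx : 0 < x) (N : ℕ) :
    ∃ K : ℝ, ∀ t : ℝ, 0 ≤ t → Real.exp (-(x * t)) * (1 + t) ^ N ≤ K := by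
  refine ⟨N.factorial / x ^ N * Real.exp x, fun t ht => ?_⟩
  have h := Real.pow_div_factorial_le_exp (x * (1 + t)) (by positivity) N
  have hN : (0 : ℝ) < N.factorial := by exact_mod_cast N.factorial_pos
  rw [div_le_iff₀ hN, mul_pow, mul_add, mul_one, Real.exp_add] at h
  rw [Real.exp_neg, inv_mul_le_iff₀ (Real.exp_pos _), div_mul_eq_mul_div, mul_div_assoc',
    le_div_iff₀ (by positivity)]
  linarith

lemma integrableOn_tricomiKernel (b : ℝ) {a x : ℝ} (ha : 0 < a) (hx : 0 < x) :
    IntegrableOn (tricomiKernel a b x) (Set.Ioi 0) := by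
  -- Lowering `b` by `N` makes the weight integrable at infinity; the exponential absorbs the factor
  -- `(1+t) ^ N`.
  obtain ⟨N, hN⟩ := exists_nat_gt (a + b)
  obtain ⟨K, hK⟩ := exists_exp_mul_pow_le hx N
  refine Integrable.mono' ((integrableOn_beta_kernel (b := b - N) ha (by linarith)).const_mul K)
    ((continuousOn_tricomiKernel a b x).aestronglyMeasurable measurableSet_Ioi) ?_
  refine (ae_restrict_iff' measurableSet_Ioi).2 (Eventually.of_forall fun t ht => ?_)
  have ht : 0 < t := ht
  have h1 : (1 + t) ^ b = (1 + t) ^ N * (1 + t) ^ (b - N) := by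
    rw [← Real.rpow_natCast, ← Real.rpow_add (by positivity), add_sub_cancel]
  rw [Real.norm_of_nonneg (by unfold tricomiKernel; positivity), tricomiKernel, h1]
  calc Real.exp (-(x * t)) * (t ^ (a - 1) * ((1 + t) ^ N * (1 + t) ^ (b - N)))
      = Real.exp (-(x * t)) * (1 + t) ^ N * (t ^ (a - 1) * (1 + t) ^ (b - N)) := by ring
    _ ≤ _ := mul_le_mul_of_nonneg_right (hK t ht.le) (by positivity)

lemma integrableOn_tricomiKernel_zero {a b : ℝ} (ha : 0 < a) (hab : a + b < 0) :
    IntegrableOn (tricomiKernel a b 0) (Set.Ioi 0) := by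
  have : tricomiKernel a b 0 = fun t : ℝ => t ^ (a - 1) * (1 + t) ^ b := by
    funext t; simp [tricomiKernel]
  rw [this]
  exact integrableOn_beta_kernel ha hab

lemma tricomiKernel_pos (a b x : ℝ) {t : ℝ} (ht : 0 < t) : 0 < tricomiKernel a b x t := by
  unfold tricomiKernel; positivity

lemma tricomiIntegral_pos (b : ℝ) {a x : ℝ} (ha : 0 < a) (hx : 0 < x) :
    0 < tricomiIntegral a b x := by
  rw [tricomiIntegral, setIntegral_pos_iff_support_of_nonneg_ae]
  · have : Set.Ioi (0 : ℝ) ⊆ Function.support (tricomiKernel a b x) ∩ Set.Ioi 0 :=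
      fun t ht => ⟨(tricomiKernel_pos a b x ht).ne', ht⟩
    exact lt_of_lt_of_le (by simp) (measure_mono this)
  · exact (ae_restrict_iff' measurableSet_Ioi).2
      (Eventually.of_forall fun t ht => (tricomiKernel_pos a b x ht).le)
  · exact integrableOn_tricomiKernel b ha hx

lemma tricomiKernel_succ_left (a b x : ℝ) {t : ℝ} (ht : 0 < t) :
    tricomiKernel (a + 1) b x t = t * tricomiKernel a b x t := by
  rw [tricomiKernel, tricomiKernel, show a + 1 - 1 = (a - 1) + 1 by ring, Real.rpow_add_one ht.ne']
  ring

lemma tricomiKernel_succ_right (a b x : ℝ) {t : ℝ} (ht : 0 < t) :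
    tricomiKernel a (b + 1) x t = (1 + t) * tricomiKernel a b x t := by
  rw [tricomiKernel, tricomiKernel, Real.rpow_add_one (by positivity)]
  ring

lemma hasDerivAt_tricomiIntegral (b : ℝ) {a x : ℝ} (ha : 0 < a) (hx : 0 < x) :
    HasDerivAt (tricomiIntegral a b) (-tricomiIntegral (a + 1) b x) x := by
  have key := hasDerivAt_integral_of_dominated_loc_of_deriv_le
    (μ := volume.restrict (Set.Ioi (0 : ℝ))) (F := fun y t => tricomiKernel a b y t)
    (F' := fun y t => -tricomiKernel (a + 1) b y t) (x₀ := x) (s := Set.Ioi (x / 2))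
    (bound := tricomiKernel (a + 1) b (x / 2)) (Ioi_mem_nhds (by linarith))
    (Eventually.of_forall fun y =>
      (continuousOn_tricomiKernel a b y).aestronglyMeasurable measurableSet_Ioi)
    (integrableOn_tricomiKernel b ha hx)
    ((continuousOn_tricomiKernel (a + 1) b x).neg.aestronglyMeasurable measurableSet_Ioi)
    ?_ (integrableOn_tricomiKernel b (by linarith) (by linarith)) ?_
  · have h := key.2
    rwa [integral_neg] at h
  · refine (ae_restrict_iff' measurableSet_Ioi).2 (Eventually.of_forall fun t ht y hy => ?_)
    have ht : 0 < t := ht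
    have hy : x / 2 < y := hy
    rw [norm_neg, Real.norm_of_nonneg (tricomiKernel_pos _ _ _ ht).le, tricomiKernel,
      tricomiKernel]
    gcongr
  · refine (ae_restrict_iff' measurableSet_Ioi).2 (Eventually.of_forall fun t ht y _ => ?_)
    have ht : 0 < t := ht
    rw [tricomiKernel_succ_left a b y ht]
    have h1 : HasDerivAt (fun z : ℝ => Real.exp (-(z * t))) (Real.exp (-(y * t)) * (-(1 * t))) y :=
      ((hasDerivAt_id y).mul_const t).neg.exp
    convert! h1.mul_const (t ^ (a - 1) * (1 + t) ^ b) using 1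
    rw [tricomiKernel]
    ring

lemma integral_Ioi_eq_zero_of_primitive {g g' : ℝ → ℝ} (h0 : g 0 = 0)
    (hc : ContinuousWithinAt g (Set.Ici 0) 0) (hd : ∀ t ∈ Set.Ioi (0 : ℝ), HasDerivAt g (g' t) t)
    (hi : IntegrableOn g' (Set.Ioi 0)) (ht : Tendsto g atTop (𝓝 0)) :
    ∫ t in Set.Ioi (0 : ℝ), g' t = 0 := by
  rw [integral_Ioi_of_hasDerivAt_of_tendsto hc hd hi ht, h0, sub_zero]

lemma hasDerivAt_rpow_mul_one_add_rpow (a b : ℝ) {t : ℝ} (ht : 0 < t) :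
    HasDerivAt (fun s : ℝ => s ^ a * (1 + s) ^ (b + 1))
      (t ^ (a - 1) * (1 + t) ^ b * (a * (1 + t) + (b + 1) * t)) t := by
  have h1 : HasDerivAt (fun s : ℝ => s ^ a) (a * t ^ (a - 1)) t :=
    Real.hasDerivAt_rpow_const (Or.inl ht.ne')
  have h2 : HasDerivAt (fun s : ℝ => (1 + s) ^ (b + 1)) ((b + 1) * (1 + t) ^ b) t := by
    have := ((hasDerivAt_id t).const_add 1).rpow_const (p := b + 1)
      (Or.inl (by simp; positivity))
    simpa using this
  convert! h1.mul h2 using 1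
  rw [Real.rpow_add_one (by positivity)]
  have : t ^ a = t ^ (a - 1) * t := by rw [← Real.rpow_add_one ht.ne', sub_add_cancel]
  rw [this]
  ring

lemma continuousAt_rpow_mul_one_add_rpow {a : ℝ} (b : ℝ) (ha : 0 < a) :
    ContinuousAt (fun s : ℝ => s ^ a * (1 + s) ^ b) 0 :=
  ContinuousAt.mul (Real.continuousAt_rpow_const _ _ (Or.inr ha.le))
    (ContinuousAt.rpow_const (by fun_prop) (Or.inl (by norm_num)))

/-- Up to sign, the combined integrand is the derivative of `e^{-xt} t^a (1+t)^{b+1}`, which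
vanishes at `0` and at infinity. -/
lemma tricomiIntegral_kummer (b : ℝ) {a x : ℝ} (ha : 0 < a) (hx : 0 < x) :
    x * tricomiIntegral (a + 1 + 1) b x
      + (a + b + 1 - x) * -tricomiIntegral (a + 1) b x - a * tricomiIntegral a b x = 0 := by
  have i0 := integrableOn_tricomiKernel b ha hx
  have i1 := integrableOn_tricomiKernel b (a := a + 1) (by linarith) hx
  have i2 := integrableOn_tricomiKernel b (a := a + 1 + 1) (by linarith) hx
  have key : ∫ t in Set.Ioi (0 : ℝ), (a * tricomiKernel a b x t
      + (a + b + 1 - x) * tricomiKernel (a + 1) b x t - x * tricomiKernel (a + 1 + 1) b x t) = 0 := by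
    refine integral_Ioi_eq_zero_of_primitive
      (g := fun t => Real.exp (-(x * t)) * (t ^ a * (1 + t) ^ (b + 1))) ?_ ?_ ?_ ?_ ?_
    · simp [Real.zero_rpow ha.ne']
    · exact (ContinuousAt.mul (by fun_prop)
        (continuousAt_rpow_mul_one_add_rpow _ ha)).continuousWithinAt
    · intro t ht
      have ht : 0 < t := ht
      have h1 : HasDerivAt (fun z : ℝ => Real.exp (-(x * z)))
          (Real.exp (-(x * t)) * (-(x * 1))) t :=
        ((hasDerivAt_id t).const_mul x).neg.exp
      convert! h1.mul (hasDerivAt_rpow_mul_one_add_rpow a b ht) using 1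
      have : t ^ a = t ^ (a - 1) * t := by rw [← Real.rpow_add_one ht.ne', sub_add_cancel]
      rw [tricomiKernel_succ_left (a + 1) _ _ ht, tricomiKernel_succ_left a _ _ ht, tricomiKernel, this,
        Real.rpow_add_one (by positivity)]
      ring
    · exact ((i0.const_mul _).add (i1.const_mul _)).sub (i2.const_mul _)
    · have h1 : Tendsto (fun t : ℝ => (1 + t) ^ (a + b + 1) * Real.exp (-x * (1 + t)) * Real.exp x)
          atTop (𝓝 (0 * Real.exp x)) :=
        ((tendsto_rpow_mul_exp_neg_mul_atTop_nhds_zero (a + b + 1) x hx).comp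
          (tendsto_atTop_add_const_left _ 1 tendsto_id)).mul_const _
      rw [zero_mul] at h1
      refine squeeze_zero' ?_ ?_ h1
      · filter_upwards [eventually_gt_atTop 0] with t ht
        positivity
      · filter_upwards [eventually_gt_atTop 0] with t ht
        rw [mul_assoc ((1 + t) ^ _), ← Real.exp_add, show -x * (1 + t) + x = -(x * t) by ring,
          mul_comm, show a + b + 1 = a + (b + 1) by ring, Real.rpow_add (by positivity) a (b + 1)]
        gcongr
        linarith
  have i01 : IntegrableOn (fun t => a * tricomiKernel a b x t
      + (a + b + 1 - x) * tricomiKernel (a + 1) b x t) (Set.Ioi 0) :=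
    (i0.const_mul _).add (i1.const_mul _)
  rw [integral_sub i01 (i2.const_mul _),
    integral_add (i0.const_mul _) (i1.const_mul _), integral_const_mul, integral_const_mul,
    integral_const_mul] at key
  simp only [tricomiIntegral]
  linear_combination (-1 : ℝ) * key

/-! ### The Tricomi function as an integral -/

/-- Substituting `s = x t` leaves `(1 + s/x)^b`, which tends to `1` and is dominated by
`(1+s)^{|b|}` for `x ≥ 1`. -/
lemma tendsto_rpow_mul_tricomiIntegral (b : ℝ) {a : ℝ} (ha : 0 < a) :
    Tendsto (fun x : ℝ => x ^ a * tricomiIntegral a b x) atTop (𝓝 (Real.Gamma a)) := by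
  have h1 : Tendsto (fun x : ℝ => ∫ s in Set.Ioi (0 : ℝ),
      Real.exp (-s) * s ^ (a - 1) * (1 + s / x) ^ b) atTop
      (𝓝 (∫ s in Set.Ioi (0 : ℝ), Real.exp (-s) * s ^ (a - 1))) := by
    refine tendsto_integral_filter_of_dominated_convergence (tricomiKernel a |b| 1) ?_ ?_
      (integrableOn_tricomiKernel _ ha one_pos) ?_
    · filter_upwards [eventually_gt_atTop 0] with x hx
      refine ContinuousOn.aestronglyMeasurable (fun t ht => ?_) measurableSet_Ioi
      have ht : 0 < t := ht
      refine ContinuousAt.continuousWithinAt (ContinuousAt.mul (ContinuousAt.mul (by fun_prop) ?_) ?_)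
      · exact Real.continuousAt_rpow_const _ _ (Or.inl ht.ne')
      · exact ContinuousAt.rpow_const (by fun_prop) (Or.inl (by positivity))
    · filter_upwards [eventually_ge_atTop 1] with x hx
      refine (ae_restrict_iff' measurableSet_Ioi).2 (Eventually.of_forall fun s hs => ?_)
      have hs : 0 < s := hs
      have hx0 : 0 < x := by linarith
      rw [Real.norm_of_nonneg (by positivity), tricomiKernel, one_mul, mul_assoc]
      have h2 : (1 + s / x) ^ b ≤ (1 + s) ^ |b| :=
        (Real.rpow_le_rpow_of_exponent_le (by simp; positivity) (le_abs_self b)).trans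
          (Real.rpow_le_rpow (by positivity) (by gcongr; exact div_le_self hs.le hx)
            (abs_nonneg b))
      gcongr
    · refine (ae_restrict_iff' measurableSet_Ioi).2 (Eventually.of_forall fun s hs => ?_)
      have h3 : Tendsto (fun x : ℝ => (1 + s / x) ^ b) atTop (𝓝 ((1 + 0) ^ b)) :=
        ((tendsto_const_nhds.div_atTop tendsto_id).const_add 1).rpow_const (Or.inl (by norm_num))
      simpa using h3.const_mul (Real.exp (-s) * s ^ (a - 1))
  rw [← Real.Gamma_eq_integral ha] at h1
  refine h1.congr' ?_
  filter_upwards [eventually_gt_atTop 0] with x hx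
  have h4 := integral_comp_mul_left_Ioi
    (fun s => Real.exp (-s) * s ^ (a - 1) * (1 + s / x) ^ b) 0 hx
  rw [mul_zero, smul_eq_mul] at h4
  have h5 : (∫ s in Set.Ioi (0 : ℝ), Real.exp (-s) * s ^ (a - 1) * (1 + s / x) ^ b)
      = x * ∫ t in Set.Ioi (0 : ℝ),
          Real.exp (-(x * t)) * (x * t) ^ (a - 1) * (1 + x * t / x) ^ b := by
    rw [h4, mul_inv_cancel_left₀ hx.ne']
  rw [h5, tricomiIntegral, ← integral_const_mul, ← integral_const_mul]
  refine setIntegral_congr_fun measurableSet_Ioi fun t ht => ?_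
  have ht : 0 < t := ht
  have h6 : x ^ a = x * x ^ (a - 1) := by rw [mul_comm, ← Real.rpow_add_one hx.ne', sub_add_cancel]
  simp only [tricomiKernel]
  rw [Real.mul_rpow hx.le ht.le, h6, mul_div_cancel_left₀ _ hx.ne']
  ring

/-- The integral representation of the Tricomi function, for `a > 0`. -/
lemma isTricomiSolution_tricomiIntegral (c : ℝ) {a : ℝ} (ha : 0 < a) :
    IsTricomiSolution a c (fun x => tricomiIntegral a (c - a - 1) x / Real.Gamma a) := by
  set b := c - a - 1
  have hG : Real.Gamma a ≠ 0 := (Real.Gamma_pos_of_pos ha).ne'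
  have hd (x : ℝ) (hx : 0 < x) : HasDerivAt (fun x => tricomiIntegral a b x / Real.Gamma a)
      (-tricomiIntegral (a + 1) b x / Real.Gamma a) x :=
    (hasDerivAt_tricomiIntegral b ha hx).div_const _
  have hd2 (x : ℝ) (hx : 0 < x) :
      HasDerivAt (deriv fun x => tricomiIntegral a b x / Real.Gamma a)
        (tricomiIntegral (a + 1 + 1) b x / Real.Gamma a) x := by
    have h1 := ((hasDerivAt_tricomiIntegral b (a := a + 1) (by linarith) hx).neg).div_const
      (Real.Gamma a)
    rw [neg_neg] at h1
    refine h1.congr_of_eventuallyEq ?_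
    filter_upwards [Ioi_mem_nhds hx] with y hy
    exact (hd y hy).deriv
  refine ⟨fun x hx => (hd x hx).differentiableAt.differentiableWithinAt,
    fun x hx => (hd2 x hx).differentiableAt.differentiableWithinAt, fun x hx => ?_, ?_⟩
  · rw [(hd x hx).deriv, (hd2 x hx).deriv, show c = a + b + 1 by simp only [b]; ring]
    have := tricomiIntegral_kummer b ha hx
    field_simp
    linear_combination this
  · refine (isEquivalent_iff_tendsto_one ?_).2 ?_
    · filter_upwards [eventually_gt_atTop 0] with x hx h
      exact absurd h (by positivity)
    · have h1 := (tendsto_rpow_mul_tricomiIntegral b ha).div_const (Real.Gamma a)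
      rw [div_self hG] at h1
      refine h1.congr' ?_
      filter_upwards [eventually_gt_atTop 0] with x hx
      simp only [Pi.div_apply]
      rw [Real.rpow_neg hx.le]
      field_simp

/-- Two Tricomi solutions agree if one of them is positive: the Wronskian is a constant multiple of
`e^x x^{-c}`, and a nonzero constant would force the quotient to diverge at infinity. -/
lemma IsTricomiSolution.eq_of_pos {a c : ℝ} (ha : 0 < a) {y z : ℝ → ℝ}
    (hy : IsTricomiSolution a c y) (hz : IsTricomiSolution a c z) (hpos : ∀ x, 0 < x → 0 < z x)
    {x : ℝ} (hx : 0 < x) : y x = z x := by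
  have dy (x : ℝ) (hx : 0 < x) : HasDerivAt y (deriv y x) x :=
    (hy.differentiableOn.differentiableAt (Ioi_mem_nhds hx)).hasDerivAt
  have dz (x : ℝ) (hx : 0 < x) : HasDerivAt z (deriv z x) x :=
    (hz.differentiableOn.differentiableAt (Ioi_mem_nhds hx)).hasDerivAt
  have ddy (x : ℝ) (hx : 0 < x) : HasDerivAt (deriv y) (deriv (deriv y) x) x :=
    (hy.differentiableOn_deriv.differentiableAt (Ioi_mem_nhds hx)).hasDerivAt
  have ddz (x : ℝ) (hx : 0 < x) : HasDerivAt (deriv z) (deriv (deriv z) x) x :=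
    (hz.differentiableOn_deriv.differentiableAt (Ioi_mem_nhds hx)).hasDerivAt
  set W : ℝ → ℝ := fun x => deriv y x * z x - y x * deriv z x with hW
  have dE (x : ℝ) (hx : 0 < x) : HasDerivAt (fun x => W x * (x ^ c * Real.exp (-x))) 0 x := by
    have h1 := ((ddy x hx).mul (dz x hx)).sub ((dy x hx).mul (ddz x hx))
    have h2 : HasDerivAt (fun x : ℝ => x ^ c) (c * x ^ (c - 1)) x :=
      Real.hasDerivAt_rpow_const (Or.inl hx.ne')
    have h3 : HasDerivAt (fun x : ℝ => Real.exp (-x)) (Real.exp (-x) * -1) x :=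
      (hasDerivAt_id x).neg.exp
    have h4 := h1.mul (h2.mul h3)
    convert! h4 using 1
    have h5 : x ^ c = x ^ (c - 1) * x := by rw [← Real.rpow_add_one hx.ne', sub_add_cancel]
    simp only [Pi.mul_apply, Pi.sub_apply]
    rw [h5]
    linear_combination (-x ^ (c - 1) * Real.exp (-x)) *
      (z x * hy.kummer x hx - y x * hz.kummer x hx)
  have dg (x : ℝ) (hx : 0 < x) : HasDerivAt (fun x => y x / z x) (W x / z x ^ 2) x :=
    (dy x hx).div (dz x hx) (hpos x hx).ne'
  obtain ⟨K, hK⟩ : ∃ K, ∀ x, 0 < x → W x * (x ^ c * Real.exp (-x)) = K :=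
    ⟨_, fun x hx => isOpen_Ioi.is_const_of_deriv_eq_zero isPreconnected_Ioi
      (fun x hx => (dE x hx).differentiableAt.differentiableWithinAt)
      (fun x hx => (dE x hx).deriv) hx (Set.mem_Ioi.2 one_pos)⟩
  have hg1 : Tendsto (fun x => y x / z x) atTop (𝓝 1) :=
    (isEquivalent_iff_tendsto_one
      ((eventually_gt_atTop 0).mono fun x hx => (hpos x hx).ne')).1
      (hy.isEquivalent.trans hz.isEquivalent.symm)
  have hz0 : Tendsto z atTop (𝓝 0) :=
    hz.isEquivalent.symm.tendsto_nhds (tendsto_rpow_neg_atTop ha)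
  have hK0 : K = 0 := by
    -- If `K ≠ 0`, the derivative of `y / z` is eventually at least `1` in absolute value, since
    -- `e^x / x^c` diverges and `z → 0`. By the mean value theorem the increments over `[x, x+1]`
    -- cannot tend to `0`, although `y / z → 1`.
    by_contra hne
    have hdiff : Tendsto (fun x => y (x + 1) / z (x + 1) - y x / z x) atTop (𝓝 (1 - 1)) :=
      (hg1.comp (tendsto_atTop_add_const_right _ 1 tendsto_id)).sub hg1
    rw [sub_self] at hdiff
    have hexp : Tendsto (fun x : ℝ => |K| * (Real.exp x / x ^ c)) atTop atTop :=
      (tendsto_exp_div_rpow_atTop c).const_mul_atTop (abs_pos.2 hne)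
    have hbig : ∀ᶠ x in atTop, 1 ≤ |W x / z x ^ 2| := by
      filter_upwards [eventually_gt_atTop 0, hexp.eventually_ge_atTop 1,
        hz0.eventually_le_const zero_lt_one] with x hx h1 h2
      have hxc : 0 < x ^ c := Real.rpow_pos_of_pos hx c
      have hWx : W x = K * (Real.exp x / x ^ c) := by
        rw [← hK x hx, Real.exp_neg]
        field_simp
      have hz2 : z x ^ 2 ≤ 1 := pow_le_one₀ (hpos x hx).le h2
      have hzp : 0 < z x ^ 2 := pow_pos (hpos x hx) 2
      rw [hWx, abs_div, abs_mul, abs_of_pos (div_pos (Real.exp_pos x) hxc), abs_of_pos hzp,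
        le_div_iff₀ hzp]
      linarith
    obtain ⟨N, hN⟩ := eventually_atTop.1 (hbig.and (eventually_gt_atTop 0))
    obtain ⟨x, hx1, hx2⟩ := ((eventually_ge_atTop N).and
      (hdiff.abs.eventually_lt_const (show |(0 : ℝ)| < 1 by simp))).exists
    have hx0 : 0 < x := (hN x hx1).2
    obtain ⟨ξ, hξ, hξ'⟩ := exists_hasDerivAt_eq_slope (fun x => y x / z x)
      (fun x => W x / z x ^ 2) (show x < x + 1 by linarith)
      (fun s hs => (dg s (by linarith [hs.1])).continuousAt.continuousWithinAt)
      (fun s hs => dg s (by linarith [hs.1]))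
    have := (hN ξ (by linarith [hξ.1])).1
    rw [hξ', show x + 1 - x = 1 by ring, div_one] at this
    linarith
  have hW0 (x : ℝ) (hx : 0 < x) : W x = 0 := by
    have := hK x hx
    rw [hK0] at this
    exact (mul_eq_zero.1 this).resolve_right
      (mul_pos (Real.rpow_pos_of_pos hx c) (Real.exp_pos _)).ne'
  have hconst (s : ℝ) (hs : 0 < s) : y s / z s = y x / z x :=
    isOpen_Ioi.is_const_of_deriv_eq_zero (f := fun x => y x / z x) isPreconnected_Ioi
      (fun x hx => (dg x hx).differentiableAt.differentiableWithinAt)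
      (fun x hx => by rw [(dg x hx).deriv, hW0 x hx]; simp) hs hx
  have h1 : y x / z x = 1 := tendsto_nhds_unique
    (tendsto_const_nhds.congr' ((eventually_gt_atTop 0).mono fun s hs => (hconst s hs).symm)) hg1
  exact (div_eq_one_iff_eq (hpos x hx).ne').1 h1

/-- Existence and uniqueness on `(0, ∞)` make the arbitrary choice immaterial there. -/
lemma epsilon_isTricomiSolution (c : ℝ) {a x : ℝ} (ha : 0 < a) (hx : 0 < x) :
    Classical.epsilon (IsTricomiSolution a c) x
      = tricomiIntegral a (c - a - 1) x / Real.Gamma a :=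
  IsTricomiSolution.eq_of_pos ha
    (Classical.epsilon_spec ⟨_, isTricomiSolution_tricomiIntegral c ha⟩)
    (isTricomiSolution_tricomiIntegral c ha)
    (fun _ hx => div_pos (tricomiIntegral_pos _ ha hx) (Real.Gamma_pos_of_pos ha)) hx

lemma tricomiU_of_pos (c : ℝ) {a x : ℝ} (ha : 0 < a) (hx : 0 < x) :
    tricomiU a c x = tricomiIntegral a (c - a - 1) x / Real.Gamma a := by
  rw [tricomiU, if_pos hx, epsilon_isTricomiSolution c ha hx]

lemma tendsto_tricomiIntegral_zero {a b : ℝ} (ha : 0 < a) (hab : a + b < 0) :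
    Tendsto (tricomiIntegral a b) (𝓝[>] 0) (𝓝 (tricomiIntegral a b 0)) := by
  refine tendsto_integral_filter_of_dominated_convergence (tricomiKernel a b 0) ?_ ?_
    (integrableOn_tricomiKernel_zero ha hab) ?_
  · exact Eventually.of_forall fun x =>
      (continuousOn_tricomiKernel a b x).aestronglyMeasurable measurableSet_Ioi
  · filter_upwards [self_mem_nhdsWithin] with x hx
    have hx : 0 < x := hx
    refine (ae_restrict_iff' measurableSet_Ioi).2 (Eventually.of_forall fun t ht => ?_)
    have ht : 0 < t := ht
    rw [Real.norm_of_nonneg (tricomiKernel_pos a b x ht).le, tricomiKernel, tricomiKernel]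
    gcongr
  · refine (ae_restrict_iff' measurableSet_Ioi).2 (Eventually.of_forall fun t ht => ?_)
    have : Continuous fun x => tricomiKernel a b x t := by unfold tricomiKernel; fun_prop
    exact this.continuousAt.continuousWithinAt

lemma tricomiU_zero {a c : ℝ} (ha : 0 < a) (hc : c < 1) :
    tricomiU a c 0 = tricomiIntegral a (c - a - 1) 0 / Real.Gamma a := by
  rw [tricomiU, if_neg (lt_irrefl _)]
  refine Tendsto.limUnder_eq ?_
  refine ((tendsto_tricomiIntegral_zero ha (by linarith)).div_const (Real.Gamma a)).congr' ?_
  filter_upwards [self_mem_nhdsWithin] with x hx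
  rw [epsilon_isTricomiSolution c ha hx]

/-- The integral with exponent `b + 1` may diverge at `x = 0`. For `0 < x < 1` the bound `x (1+t)
e^{-xt} ≤ 2` dominates the integrand by the integrable weight with exponent `b`. -/
lemma tendsto_mul_tricomiIntegral_zero {a b : ℝ} (ha : 0 < a) (hab : a + b < 0) :
    Tendsto (fun x => x * tricomiIntegral a (b + 1) x) (𝓝[>] 0) (𝓝 0) := by
  have h1 : Tendsto (fun x => ∫ t in Set.Ioi (0 : ℝ), x * tricomiKernel a (b + 1) x t) (𝓝[>] 0)
      (𝓝 (∫ t in Set.Ioi (0 : ℝ), 0)) := by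
    refine tendsto_integral_filter_of_dominated_convergence
      (fun t => 2 * tricomiKernel a b 0 t) ?_ ?_
      ((integrableOn_tricomiKernel_zero ha hab).const_mul 2) ?_
    · exact Eventually.of_forall fun x =>
        ((continuousOn_tricomiKernel a (b + 1) x).const_mul x).aestronglyMeasurable
          measurableSet_Ioi
    · filter_upwards [self_mem_nhdsWithin,
        mem_nhdsWithin_of_mem_nhds (Iio_mem_nhds zero_lt_one)] with x hx hx1
      have hx : 0 < x := hx
      have hx1 : x < 1 := hx1
      refine (ae_restrict_iff' measurableSet_Ioi).2 (Eventually.of_forall fun t ht => ?_)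
      have ht : 0 < t := ht
      have h2 : x * (1 + t) * Real.exp (-(x * t)) ≤ 2 := by
        rw [Real.exp_neg, mul_inv_le_iff₀ (Real.exp_pos _)]
        nlinarith [Real.add_one_le_exp (x * t), Real.one_le_exp (mul_pos hx ht).le]
      rw [Real.norm_of_nonneg (mul_nonneg hx.le (tricomiKernel_pos _ _ _ ht).le),
        tricomiKernel_succ_right _ _ _ ht, tricomiKernel, tricomiKernel]
      calc x * ((1 + t) * (Real.exp (-(x * t)) * (t ^ (a - 1) * (1 + t) ^ b)))
          = (x * (1 + t) * Real.exp (-(x * t))) * (t ^ (a - 1) * (1 + t) ^ b) := by ring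
        _ ≤ 2 * (t ^ (a - 1) * (1 + t) ^ b) := by gcongr
        _ = _ := by simp
    · refine (ae_restrict_iff' measurableSet_Ioi).2 (Eventually.of_forall fun t ht => ?_)
      have h3 : Continuous fun x => x * tricomiKernel a (b + 1) x t := by
        unfold tricomiKernel; fun_prop
      have h4 := h3.tendsto 0
      rw [zero_mul] at h4
      exact h4.mono_left nhdsWithin_le_nhds
  simpa [tricomiIntegral, integral_const_mul] using h1

/-! ### Mellin transforms and moments -/

/-- Fubini for a nonnegative integrand: the inner integral over `x` is `Γ(σ) (1 + κ t)^{-σ}` times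
the weight in `t`. -/
lemma integral_rpow_mul_exp_mul_tricomiIntegral {a b σ κ : ℝ} (hσ : 0 < σ) (hκ : 0 < κ)
    (hint : IntegrableOn (fun t : ℝ => t ^ (a - 1) * (1 + t) ^ b * (1 + κ * t) ^ (-σ))
      (Set.Ioi 0)) :
    IntegrableOn (fun x : ℝ => x ^ (σ - 1) * Real.exp (-x) * tricomiIntegral a b (κ * x))
        (Set.Ioi 0) ∧
      ∫ x in Set.Ioi (0 : ℝ), x ^ (σ - 1) * Real.exp (-x) * tricomiIntegral a b (κ * x)
        = Real.Gamma σ *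
          ∫ t in Set.Ioi (0 : ℝ), t ^ (a - 1) * (1 + t) ^ b * (1 + κ * t) ^ (-σ) := by
  set f : ℝ → ℝ → ℝ := fun x t => x ^ (σ - 1) * Real.exp (-x) * tricomiKernel a b (κ * x) t with hf
  have hfac (x t : ℝ) : f x t
      = (t ^ (a - 1) * (1 + t) ^ b) * (x ^ (σ - 1) * Real.exp (-((1 + κ * t) * x))) := by
    simp only [hf, tricomiKernel]
    rw [show -((1 + κ * t) * x) = -x + -(κ * x * t) by ring, Real.exp_add]
    ring
  have hmeas : Measurable (Function.uncurry f) := by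
    have : Function.uncurry f = fun z : ℝ × ℝ => z.1 ^ (σ - 1) * Real.exp (-z.1) *
        (Real.exp (-(κ * z.1 * z.2)) * (z.2 ^ (a - 1) * (1 + z.2) ^ b)) := rfl
    rw [this]
    fun_prop
  have hinner (t : ℝ) (ht : 0 < t) : ∫ x in Set.Ioi (0 : ℝ), f x t
      = Real.Gamma σ * (t ^ (a - 1) * (1 + t) ^ b * (1 + κ * t) ^ (-σ)) := by
    have h1 : 0 < 1 + κ * t := by positivity
    simp_rw [hfac]
    rw [integral_const_mul, Real.integral_rpow_mul_exp_neg_mul_Ioi hσ h1, one_div,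
      Real.inv_rpow h1.le, Real.rpow_neg h1.le]
    ring
  have hinnerint (t : ℝ) (ht : 0 < t) : IntegrableOn (fun x => f x t) (Set.Ioi 0) := by
    have h1 : 0 < 1 + κ * t := by positivity
    simp_rw [hfac]
    have h2 := (integrableOn_tricomiKernel 0 hσ h1).const_mul (t ^ (a - 1) * (1 + t) ^ b)
    simpa [IntegrableOn, tricomiKernel, mul_comm, mul_left_comm, mul_assoc] using h2
  have hprod : Integrable (Function.uncurry f)
      ((volume.restrict (Set.Ioi (0 : ℝ))).prod (volume.restrict (Set.Ioi (0 : ℝ)))) := by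
    rw [integrable_prod_iff' hmeas.aestronglyMeasurable]
    refine ⟨(ae_restrict_iff' measurableSet_Ioi).2 (Eventually.of_forall hinnerint), ?_⟩
    have h3 : IntegrableOn (fun t : ℝ => Real.Gamma σ *
        (t ^ (a - 1) * (1 + t) ^ b * (1 + κ * t) ^ (-σ))) (Set.Ioi 0) := hint.const_mul _
    refine IntegrableOn.congr_fun h3 (fun t ht => ?_) measurableSet_Ioi
    have ht : 0 < t := ht
    rw [← hinner t ht]
    refine setIntegral_congr_fun measurableSet_Ioi fun x hx => ?_
    have hx : 0 < x := hx
    have : 0 ≤ f x t := by rw [hfac]; positivity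
    exact (Real.norm_of_nonneg this).symm
  have hout (x : ℝ) : ∫ t in Set.Ioi (0 : ℝ), f x t
      = x ^ (σ - 1) * Real.exp (-x) * tricomiIntegral a b (κ * x) := by
    simp only [hf, integral_const_mul, tricomiIntegral]
  refine ⟨?_, ?_⟩
  · have h4 := hprod.integral_prod_left
    simp only [Function.uncurry_apply_pair, hout] at h4
    exact h4
  · simp_rw [← hout]
    rw [integral_integral_swap hprod, ← integral_const_mul]
    exact setIntegral_congr_fun measurableSet_Ioi fun t ht => hinner t ht

lemma tricomiIntegral_zero_right {a x : ℝ} (ha : 0 < a) (hx : 0 < x) :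
    tricomiIntegral a 0 x = Real.Gamma a * x ^ (-a) := by
  have h := Real.integral_rpow_mul_exp_neg_mul_Ioi ha hx
  rw [one_div, Real.inv_rpow hx.le, ← Real.rpow_neg hx.le] at h
  rw [mul_comm, ← h, tricomiIntegral]
  simp [tricomiKernel, mul_comm]

/-- The beta integral of the second kind. -/
lemma integral_rpow_mul_one_add_rpow {a s : ℝ} (ha : 0 < a) (has : a < s) :
    ∫ t in Set.Ioi (0 : ℝ), t ^ (a - 1) * (1 + t) ^ (-s)
      = Real.Gamma a * Real.Gamma (s - a) / Real.Gamma s := by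
  have hs : 0 < s := ha.trans has
  have hint := integrableOn_beta_kernel (b := -s) ha (by linarith)
  -- Taking `b = 0`, `κ = 1` evaluates one double integral twice: as `Γ(a) Γ(s - a)`, and as `Γ(s)`
  -- times the beta integral.
  have h := (integral_rpow_mul_exp_mul_tricomiIntegral (b := 0) (κ := 1) hs one_pos
    (by simpa using hint)).2
  simp only [one_mul, Real.rpow_zero, mul_one] at h
  rw [eq_div_iff (Real.Gamma_pos_of_pos hs).ne', mul_comm, ← h,
    Real.Gamma_eq_integral (sub_pos.2 has), ← integral_const_mul]
  refine setIntegral_congr_fun measurableSet_Ioi fun x hx => ?_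
  have hx : 0 < x := hx
  rw [tricomiIntegral_zero_right ha hx, show s - a - 1 = (s - 1) + -a by ring, Real.rpow_add hx]
  ring

lemma tricomiIntegral_at_zero {a b : ℝ} (ha : 0 < a) (hab : a + b < 0) :
    tricomiIntegral a b 0 = Real.Gamma a * Real.Gamma (-a - b) / Real.Gamma (-b) := by
  have := integral_rpow_mul_one_add_rpow (s := -b) ha (by linarith)
  rw [neg_neg, show -b - a = -a - b by ring] at this
  simpa [tricomiIntegral, tricomiKernel] using this

/-- The integrand `t^{a-1} (1+t)^b (1+2t)^{-σ}`. -/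
noncomputable def eulerKernel (a b σ t : ℝ) : ℝ :=
  t ^ (a - 1) * (1 + t) ^ b * (1 + 2 * t) ^ (-σ)

/-- The integral `∫_0^∞ t^{a-1} (1+t)^b (1+2t)^{-σ} dt`. -/
noncomputable def eulerIntegral (a b σ : ℝ) : ℝ :=
  ∫ t in Set.Ioi (0 : ℝ), eulerKernel a b σ t

lemma eulerKernel_pos (a b σ : ℝ) {t : ℝ} (ht : 0 < t) : 0 < eulerKernel a b σ t := by
  unfold eulerKernel; positivity

lemma eulerKernel_succ (a b σ : ℝ) {t : ℝ} (ht : 0 < t) :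
    eulerKernel a b σ t = (1 + 2 * t) * eulerKernel a b (σ + 1) t := by
  rw [eulerKernel, eulerKernel, show -σ = -(σ + 1) + 1 by ring, Real.rpow_add_one (by positivity)]
  ring

lemma integrableOn_eulerKernel {a b σ : ℝ} (ha : 0 < a) (hσ : 0 ≤ σ) (hab : a + b < σ) :
    IntegrableOn (eulerKernel a b σ) (Set.Ioi 0) := by
  refine Integrable.mono' (integrableOn_beta_kernel (b := b - σ) ha (by linarith))
    (Measurable.aestronglyMeasurable (by unfold eulerKernel; fun_prop)) ?_
  refine (ae_restrict_iff' measurableSet_Ioi).2 (Eventually.of_forall fun t ht => ?_)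
  have ht : 0 < t := ht
  rw [Real.norm_of_nonneg (eulerKernel_pos a b σ ht).le, eulerKernel, sub_eq_add_neg b σ,
    Real.rpow_add (by positivity), mul_assoc]
  have : (1 + 2 * t) ^ (-σ) ≤ (1 + t) ^ (-σ) :=
    Real.rpow_le_rpow_of_nonpos (by positivity) (by linarith) (by linarith)
  gcongr

lemma eulerIntegral_pos {a b σ : ℝ} (ha : 0 < a) (hσ : 0 ≤ σ) (hab : a + b < σ) :
    0 < eulerIntegral a b σ := by
  rw [eulerIntegral, setIntegral_pos_iff_support_of_nonneg_ae]
  · have : Set.Ioi (0 : ℝ) ⊆ Function.support (eulerKernel a b σ) ∩ Set.Ioi 0 :=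
      fun t ht => ⟨(eulerKernel_pos a b σ ht).ne', ht⟩
    exact lt_of_lt_of_le (by simp) (measure_mono this)
  · exact (ae_restrict_iff' measurableSet_Ioi).2
      (Eventually.of_forall fun t ht => (eulerKernel_pos a b σ ht).le)
  · exact integrableOn_eulerKernel ha hσ hab

lemma eulerIntegral_zero (a b : ℝ) : eulerIntegral a b 0 = tricomiIntegral a b 0 := by
  simp [eulerIntegral, eulerKernel, tricomiIntegral, tricomiKernel]

lemma moment_tricomiIntegral {a b : ℝ} (n : ℕ) (ha : 0 < a) (hab : a + b < n + 1) :
    IntegrableOn (fun x : ℝ => x ^ n * (Real.exp (-x) * tricomiIntegral a b (2 * x)))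
        (Set.Ioi 0) ∧
      ∫ x in Set.Ioi (0 : ℝ), x ^ n * (Real.exp (-x) * tricomiIntegral a b (2 * x))
        = n.factorial * eulerIntegral a b (n + 1) := by
  have h := integral_rpow_mul_exp_mul_tricomiIntegral (b := b) (σ := n + 1) (by positivity)
    two_pos (integrableOn_eulerKernel ha (by positivity) hab)
  simp only [add_sub_cancel_right, Real.rpow_natCast, Real.Gamma_nat_eq_factorial, mul_assoc] at h
  simpa only [eulerIntegral, eulerKernel, mul_assoc] using h

/-- This is `2 (1+t) = (1+2t) + 1` under the integral. -/
lemma two_mul_eulerIntegral_succ {a b σ : ℝ} (ha : 0 < a) (hσ : 0 ≤ σ) (hab : a + b < σ) :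
    2 * eulerIntegral a (b + 1) (σ + 1) = eulerIntegral a b σ + eulerIntegral a b (σ + 1) := by
  rw [eulerIntegral, eulerIntegral, eulerIntegral, ← integral_const_mul,
    ← integral_add (integrableOn_eulerKernel ha hσ hab)
      (integrableOn_eulerKernel ha (by linarith) (by linarith))]
  refine setIntegral_congr_fun measurableSet_Ioi fun t ht => ?_
  have ht : 0 < t := ht
  rw [eulerKernel_succ a b σ ht, eulerKernel, eulerKernel, Real.rpow_add_one (by positivity)]
  ring

/-- Half of the combined integrand is the derivative of `t^a (1+t)^{b+1} (1+2t)^{-(σ+1)}`, expanded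
in powers of `1 + 2t`. The primitive is at most `(1+t)^{a+b}`, so it vanishes at infinity even for
`σ = 0`, the case needed for the first moment. -/
lemma eulerIntegral_recurrence {a b σ : ℝ} (ha : 0 < a) (hσ : 0 ≤ σ) (hab : a + b < σ)
    (hab' : a + b < 0) :
    (a + b - σ) * eulerIntegral a b σ + (a - 1 - b) * eulerIntegral a b (σ + 1)
      + (σ + 1) * eulerIntegral a b (σ + 1 + 1) = 0 := by
  have i0 := integrableOn_eulerKernel ha hσ hab
  have i1 := integrableOn_eulerKernel (σ := σ + 1) ha (by linarith) (by linarith : a + b < σ + 1)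
  have i2 := integrableOn_eulerKernel (σ := σ + 1 + 1) ha (by linarith)
    (by linarith : a + b < σ + 1 + 1)
  have i01 : IntegrableOn (fun t => (a + b - σ) / 2 * eulerKernel a b σ t
      + (a - 1 - b) / 2 * eulerKernel a b (σ + 1) t) (Set.Ioi 0) :=
    (i0.const_mul _).add (i1.const_mul _)
  have key : ∫ t in Set.Ioi (0 : ℝ), ((a + b - σ) / 2 * eulerKernel a b σ t
      + (a - 1 - b) / 2 * eulerKernel a b (σ + 1) t
      + (σ + 1) / 2 * eulerKernel a b (σ + 1 + 1) t) = 0 := by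
    refine integral_Ioi_eq_zero_of_primitive
      (g := fun t => t ^ a * (1 + t) ^ (b + 1) * (1 + 2 * t) ^ (-(σ + 1))) ?_ ?_ ?_ ?_ ?_
    · simp [Real.zero_rpow ha.ne']
    · exact ((continuousAt_rpow_mul_one_add_rpow _ ha).mul
        (ContinuousAt.rpow_const (by fun_prop) (Or.inl (by norm_num)))).continuousWithinAt
    · intro t ht
      have ht : 0 < t := ht
      have h1 : HasDerivAt (fun s : ℝ => (1 + 2 * s) ^ (-(σ + 1)))
          (2 * 1 * -(σ + 1) * (1 + 2 * t) ^ (-(σ + 1) - 1)) t :=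
        (((hasDerivAt_id t).const_mul 2).const_add 1).rpow_const
          (Or.inl (by simp; positivity))
      convert! (hasDerivAt_rpow_mul_one_add_rpow a b ht).mul h1 using 1
      have h2 : t ^ a = t ^ (a - 1) * t := by rw [← Real.rpow_add_one ht.ne', sub_add_cancel]
      have h3 : (1 + 2 * t) ^ (-(σ + 1)) = (1 + 2 * t) ^ (-(σ + 1 + 1)) * (1 + 2 * t) := by
        rw [← Real.rpow_add_one (by positivity)]; congr 1; ring
      rw [eulerKernel_succ a b σ ht, eulerKernel_succ a b (σ + 1) ht, eulerKernel, h2, h3,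
        show -(σ + 1) - 1 = -(σ + 1 + 1) by ring, Real.rpow_add_one (by positivity)]
      ring
    · exact i01.add (i2.const_mul _)
    · have h1 : Tendsto (fun t : ℝ => (1 + t) ^ (-(-(a + b)))) atTop (𝓝 0) :=
        (tendsto_rpow_neg_atTop (by linarith : 0 < -(a + b))).comp
          (tendsto_atTop_add_const_left _ 1 tendsto_id)
      refine squeeze_zero' ?_ ?_ h1
      · filter_upwards [eventually_gt_atTop 0] with t ht
        positivity
      · filter_upwards [eventually_gt_atTop 0] with t ht
        have h2 : (1 + 2 * t) ^ (-(σ + 1)) ≤ (1 + t) ^ (-1 : ℝ) :=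
          (Real.rpow_le_rpow_of_exponent_le (by linarith) (by linarith)).trans
            (Real.rpow_le_rpow_of_nonpos (by positivity) (by linarith) (by norm_num))
        have h3 : t ^ a ≤ (1 + t) ^ a := Real.rpow_le_rpow ht.le (by linarith) ha.le
        calc t ^ a * (1 + t) ^ (b + 1) * (1 + 2 * t) ^ (-(σ + 1))
            ≤ (1 + t) ^ a * (1 + t) ^ (b + 1) * (1 + t) ^ (-1 : ℝ) := by gcongr
          _ = _ := by
            rw [← Real.rpow_add (by positivity), ← Real.rpow_add (by positivity)]
            congr 1; ring
  rw [integral_add i01 (i2.const_mul _), integral_add (i0.const_mul _) (i1.const_mul _),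
    integral_const_mul, integral_const_mul, integral_const_mul] at key
  simp only [eulerIntegral]
  linear_combination 2 * key

lemma Gamma_add_natCast {a : ℝ} (ha : 0 < a) (n : ℕ) :
    Real.Gamma (a + n) = Real.Gamma a * (ascPochhammer ℝ n).eval a := by
  induction n with
  | zero => simp
  | succ n ih =>
    rw [ascPochhammer_succ_eval, ← mul_assoc, ← ih, Nat.cast_succ, ← add_assoc,
      Real.Gamma_add_one (by positivity), mul_comm]

/-- The Euler integral of a Gauss hypergeometric function at `-1`. -/
lemma eulerIntegral_one_eq {a b : ℝ} (ha : 0 < a) (hab : a + b < 0) :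
    eulerIntegral a b 1 = Real.Gamma a * Real.Gamma (1 - a - b) / Real.Gamma (1 - b) *
      ₂F₁ (1 : ℝ) a (1 - b) (-1 : ℝ) := by
  -- Here `1/(1+2t) = (1+t)⁻¹ / (1 + t/(1+t))` is expanded as a geometric series, and each term is a
  -- beta integral. The series of absolute values sums to `t^{a-1} (1+t)^b`, integrable since `a + b
  -- < 0`.
  set w : ℝ → ℝ := fun t => t ^ (a - 1) * (1 + t) ^ (b - 1) with hw
  have hwm : Measurable w := by simp only [hw]; fun_prop
  have hterm (n : ℕ) {t : ℝ} (ht : 0 < t) :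
      w t * (t / (1 + t)) ^ n = t ^ (a + n - 1) * (1 + t) ^ (-(1 - b + n)) := by
    have h1 : a + n - 1 = (a - 1) + n := by ring
    have h2 : -(1 - b + (n : ℝ)) = (b - 1) - n := by ring
    rw [h1, h2, Real.rpow_add ht (a - 1), Real.rpow_sub (by positivity) (b - 1),
      Real.rpow_natCast, Real.rpow_natCast, div_pow]
    simp only [hw]
    ring
  have hq {t : ℝ} (ht : 0 < t) : |t / (1 + t)| < 1 := by
    rw [abs_of_pos (by positivity), div_lt_one (by positivity)]; linarith
  have hb1 {t : ℝ} (ht : 0 < t) : (1 + t) ^ b = (1 + t) ^ (b - 1) * (1 + t) := by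
    rw [← Real.rpow_add_one (by positivity), sub_add_cancel]
  have hsum := hasSum_integral_of_dominated_convergence
    (μ := volume.restrict (Set.Ioi (0 : ℝ)))
    (F := fun (n : ℕ) t => w t * (-(t / (1 + t))) ^ n) (f := eulerKernel a b 1)
    (fun n t => w t * (t / (1 + t)) ^ n)
    (fun n => Measurable.aestronglyMeasurable (by fun_prop)) ?_ ?_ ?_ ?_
  · have hval (n : ℕ) : ∫ t in Set.Ioi (0 : ℝ), w t * (-(t / (1 + t))) ^ n
        = Real.Gamma a * Real.Gamma (1 - a - b) / Real.Gamma (1 - b) *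
          (((n.factorial : ℝ)⁻¹ * (ascPochhammer ℝ n).eval 1 * (ascPochhammer ℝ n).eval a *
            ((ascPochhammer ℝ n).eval (1 - b))⁻¹) • (-1) ^ n) := by
      have hn : (n.factorial : ℝ) ≠ 0 := by exact_mod_cast n.factorial_ne_zero
      have h1 : ∫ t in Set.Ioi (0 : ℝ), w t * (-(t / (1 + t))) ^ n
          = (-1) ^ n * ∫ t in Set.Ioi (0 : ℝ), t ^ (a + n - 1) * (1 + t) ^ (-(1 - b + n)) := by
        rw [← integral_const_mul]
        refine setIntegral_congr_fun measurableSet_Ioi fun t ht => ?_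
        rw [← hterm n ht, neg_pow]
        ring
      rw [h1, integral_rpow_mul_one_add_rpow (by positivity) (by linarith), Gamma_add_natCast ha,
        Gamma_add_natCast (by linarith), show 1 - b + n - (a + n) = 1 - a - b by ring,
        ascPochhammer_eval_one, smul_eq_mul, inv_mul_cancel₀ hn]
      simp only [div_eq_mul_inv, mul_inv]
      ring
    have h2 := hsum.tsum_eq
    simp_rw [hval] at h2
    rw [eulerIntegral, ← h2, tsum_mul_left, ordinaryHypergeometric_eq_tsum]
  · refine fun n => (ae_restrict_iff' measurableSet_Ioi).2 (Eventually.of_forall fun t ht => ?_)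
    have ht : 0 < t := ht
    rw [norm_mul, norm_pow, norm_neg, Real.norm_of_nonneg (by simp only [hw]; positivity),
      Real.norm_of_nonneg (by positivity)]
  · refine (ae_restrict_iff' measurableSet_Ioi).2 (Eventually.of_forall fun t ht => ?_)
    exact (summable_geometric_of_abs_lt_one (hq ht)).mul_left _
  · refine IntegrableOn.congr_fun (integrableOn_beta_kernel ha hab) (fun t ht => ?_)
      measurableSet_Ioi
    have ht : 0 < t := ht
    simp only [hw]
    rw [tsum_mul_left, tsum_geometric_of_abs_lt_one (hq ht)]
    have : 1 - t / (1 + t) = (1 + t)⁻¹ := by field_simp; ring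
    rw [this, inv_inv, hb1 ht]
    ring
  · refine (ae_restrict_iff' measurableSet_Ioi).2 (Eventually.of_forall fun t ht => ?_)
    have h1 := (hasSum_geometric_of_abs_lt_one (r := -(t / (1 + t)))
      (by rw [abs_neg]; exact hq ht)).mul_left (w t)
    have ht : 0 < t := ht
    have h2 : w t * (1 - -(t / (1 + t)))⁻¹ = eulerKernel a b 1 t := by
      simp only [hw, eulerKernel]
      have h3 : 1 - -(t / (1 + t)) = (1 + 2 * t) / (1 + t) := by field_simp; ring
      rw [hb1 ht, Real.rpow_neg_one, h3, inv_div]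
      ring
    rwa [h2] at h1

/-! ### Integral representations from moments -/

lemma hasIntegralRepresentation_of_moments {v : Module.Dual ℂ ℂ[X]} {w : ℝ → ℝ} {m : ℕ → ℝ}
    (hi : ∀ n : ℕ, Integrable fun x : ℝ => x ^ n * w x)
    (hm : ∀ n : ℕ, ∫ x : ℝ, x ^ n * w x = m n) (hv : ∀ n : ℕ, v (X ^ n) = m n) :
    HasIntegralRepresentation v w := by
  intro f
  induction f using Polynomial.induction_on' with
  | add f g hf hg =>
    simp only [eval_add, add_mul, map_add]
    exact ⟨hf.1.add hg.1, by rw [integral_add hf.1 hg.1, hf.2, hg.2]⟩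
  | monomial n c =>
    have h1 : (fun x : ℝ => (monomial n c).eval (x : ℂ) * (w x : ℂ))
        = fun x : ℝ => c * ((x ^ n * w x : ℝ) : ℂ) := by
      funext x
      simp [mul_assoc]
    rw [h1]
    refine ⟨(hi n).ofReal.const_mul c, ?_⟩
    rw [integral_const_mul, integral_complex_ofReal, hm, ← hv, ← smul_X_eq_monomial, map_smul,
      smul_eq_mul]

lemma integral_pow_mul_of_halves {w : ℝ → ℝ} {n : ℕ} {R L : ℝ}
    (hRi : IntegrableOn (fun x : ℝ => x ^ n * w x) (Set.Ioi 0))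
    (hR : ∫ x in Set.Ioi (0 : ℝ), x ^ n * w x = R)
    (hLi : IntegrableOn (fun x : ℝ => x ^ n * w (-x)) (Set.Ioi 0))
    (hL : ∫ x in Set.Ioi (0 : ℝ), x ^ n * w (-x) = L) :
    Integrable (fun x : ℝ => x ^ n * w x) ∧ ∫ x : ℝ, x ^ n * w x = R + (-1) ^ n * L := by
  have hneg : (fun x : ℝ => (-1) ^ n * (x ^ n * w (-x))) = fun x => (-x) ^ n * w (-x) := by
    funext x
    rw [neg_pow x n]
    ring
  have hLi' : IntegrableOn (fun x : ℝ => (-x) ^ n * w (-x)) (Set.Ioi 0) := by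
    rw [← hneg]
    exact hLi.const_mul _
  have h1 : IntegrableOn (fun x : ℝ => x ^ n * w x) (Set.Iic 0) := by
    have h := ((integrableOn_Ici_iff_integrableOn_Ioi enorm_ne_top).2 hLi').integrable_indicator
      measurableSet_Ici
    rw [← integrable_indicator_iff measurableSet_Iic]
    convert! h.comp_neg using 1
    funext x
    simp [Set.indicator]
  refine ⟨?_, ?_⟩
  · rw [← integrableOn_univ, ← Set.Iic_union_Ioi (a := (0 : ℝ))]
    exact h1.union hRi
  · rw [← intervalIntegral.integral_Iic_add_Ioi h1 hRi, hR, add_comm, ← hL, ← integral_const_mul,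
      hneg, integral_comp_neg_Ioi (0 : ℝ) (fun x : ℝ => x ^ n * w x), neg_zero]

/-! ### The modified Tricomi functions -/

/-- Reflection reduces each statement about the left half-line to one on the right with `p` and `q`
exchanged. -/
lemma modTricomiV_eq (x q p : ℝ) : modTricomiV x q p = modTricomiU (-x) q p := by
  rw [modTricomiV, modTricomiU, neg_neg]
  congr 2 <;> ring

lemma modTricomiU_of_pos {p x : ℝ} (q : ℝ) (hp : -1 < p) (hx : 0 < x) :
    modTricomiU x p q
      = (Real.Gamma (1 + p))⁻¹ * (Real.exp (-x) * tricomiIntegral (1 + p) q (2 * x)) := by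
  rw [modTricomiU, tricomiU_of_pos _ (by linarith) (by linarith),
    show 2 + p + q - (1 + p) - 1 = q by ring]
  ring

lemma modTricomiU_zero {p q : ℝ} (hp : -1 < p) (hpq : p + q < -1) :
    modTricomiU 0 p q = (Real.Gamma (1 + p))⁻¹ * tricomiIntegral (1 + p) q 0 := by
  rw [modTricomiU, mul_zero, tricomiU_zero (by linarith) (by linarith),
    show 2 + p + q - (1 + p) - 1 = q by ring]
  simp [div_eq_inv_mul]

lemma modTricomiU_zero_eq {p q : ℝ} (hp : -1 < p) (hpq : p + q < -1) :
    modTricomiU 0 p q = Real.Gamma (-1 - p - q) / Real.Gamma (-q) := by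
  have hG := (Real.Gamma_pos_of_pos (by linarith : 0 < 1 + p)).ne'
  rw [modTricomiU_zero hp hpq, tricomiIntegral_at_zero (by linarith) (by linarith),
    show -(1 + p) - q = -1 - p - q by ring]
  field_simp

lemma tendsto_two_mul_nhdsGT_zero : Tendsto (fun x : ℝ => 2 * x) (𝓝[>] 0) (𝓝[>] 0) := by
  refine tendsto_nhdsWithin_iff.2 ⟨?_, ?_⟩
  · have : Continuous fun x : ℝ => 2 * x := by fun_prop
    simpa using (this.tendsto 0).mono_left nhdsWithin_le_nhds
  · filter_upwards [self_mem_nhdsWithin] with x hx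
    have hx : 0 < x := hx
    exact Set.mem_Ioi.2 (by linarith)

lemma tendsto_exp_neg_nhdsGT_zero : Tendsto (fun x : ℝ => Real.exp (-x)) (𝓝[>] 0) (𝓝 1) := by
  have : Continuous fun x : ℝ => Real.exp (-x) := by fun_prop
  simpa using (this.tendsto 0).mono_left nhdsWithin_le_nhds

lemma tendsto_modTricomiU_zero {p q : ℝ} (hp : -1 < p) (hpq : p + q < -1) :
    Tendsto (fun x => modTricomiU x p q) (𝓝[>] 0) (𝓝 (modTricomiU 0 p q)) := by
  rw [modTricomiU_zero hp hpq, ← one_mul (tricomiIntegral _ _ _)]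
  have h := (tendsto_exp_neg_nhdsGT_zero.mul
    ((tendsto_tricomiIntegral_zero (a := 1 + p) (b := q) (by linarith) (by linarith)).comp
      tendsto_two_mul_nhdsGT_zero)).const_mul (Real.Gamma (1 + p))⁻¹
  refine h.congr' ?_
  filter_upwards [self_mem_nhdsWithin] with x hx
  exact (modTricomiU_of_pos q hp hx).symm

lemma tendsto_mul_modTricomiU_zero {p q : ℝ} (hp : -1 < p) (hpq : p + q < -1) :
    Tendsto (fun x => 2 * x * modTricomiU x p (1 + q)) (𝓝[>] 0) (𝓝 0) := by
  have h := (tendsto_exp_neg_nhdsGT_zero.mul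
    ((tendsto_mul_tricomiIntegral_zero (a := 1 + p) (b := q) (by linarith) (by linarith)).comp
      tendsto_two_mul_nhdsGT_zero)).const_mul (Real.Gamma (1 + p))⁻¹
  rw [mul_zero, mul_zero] at h
  refine h.congr' ?_
  filter_upwards [self_mem_nhdsWithin] with x hx
  rw [modTricomiU_of_pos _ hp hx, add_comm 1 q, Function.comp_apply]
  ring

/-- The moments on `(0, ∞)` of the modified Tricomi function. -/
lemma moment_modTricomiU {p q : ℝ} (hp : -1 < p) (hpq : p + q < -1) (n : ℕ) :
    IntegrableOn (fun x : ℝ => x ^ n * modTricomiU x p q) (Set.Ioi 0) ∧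
      ∫ x in Set.Ioi (0 : ℝ), x ^ n * modTricomiU x p q
        = (Real.Gamma (1 + p))⁻¹ * (n.factorial * eulerIntegral (1 + p) q (n + 1)) := by
  have hn : (0 : ℝ) ≤ n := n.cast_nonneg
  have h := moment_tricomiIntegral (b := q) n (by linarith : 0 < 1 + p) (by linarith)
  have heq : Set.EqOn (fun x : ℝ => (Real.Gamma (1 + p))⁻¹ *
      (x ^ n * (Real.exp (-x) * tricomiIntegral (1 + p) q (2 * x))))
      (fun x : ℝ => x ^ n * modTricomiU x p q) (Set.Ioi 0) := fun x hx => by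
    simp only [modTricomiU_of_pos q hp hx]
    ring
  refine ⟨IntegrableOn.congr_fun (h.1.const_mul _) heq measurableSet_Ioi, ?_⟩
  rw [← setIntegral_congr_fun measurableSet_Ioi heq, integral_const_mul, h.2]

/-- The factor `x` raises the moment order to `n + 1`, which is what lets
`two_mul_eulerIntegral_succ` bring the exponent `q + 1` back to `q`. -/
lemma moment_mul_modTricomiU {p q : ℝ} (hp : -1 < p) (hpq : p + q < -1) (n : ℕ) :
    IntegrableOn (fun x : ℝ => x ^ n * (2 * x * modTricomiU x p (1 + q))) (Set.Ioi 0) ∧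
      ∫ x in Set.Ioi (0 : ℝ), x ^ n * (2 * x * modTricomiU x p (1 + q))
        = (Real.Gamma (1 + p))⁻¹ * ((n + 1).factorial *
          (eulerIntegral (1 + p) q (n + 1) + eulerIntegral (1 + p) q (n + 1 + 1))) := by
  have hn : (0 : ℝ) ≤ n := n.cast_nonneg
  have h := moment_tricomiIntegral (b := q + 1) (n + 1) (by linarith : 0 < 1 + p)
    (by push_cast; linarith)
  have heq : Set.EqOn (fun x : ℝ => (2 * (Real.Gamma (1 + p))⁻¹) *
      (x ^ (n + 1) * (Real.exp (-x) * tricomiIntegral (1 + p) (q + 1) (2 * x))))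
      (fun x : ℝ => x ^ n * (2 * x * modTricomiU x p (1 + q))) (Set.Ioi 0) := fun x hx => by
    beta_reduce
    rw [modTricomiU_of_pos (1 + q) hp hx, add_comm 1 q]
    ring
  refine ⟨IntegrableOn.congr_fun (h.1.const_mul _) heq measurableSet_Ioi, ?_⟩
  rw [← setIntegral_congr_fun measurableSet_Ioi heq, integral_const_mul, h.2,
    ← two_mul_eulerIntegral_succ (by linarith) (by linarith) (by linarith)]
  push_cast
  ring

/-- The moments on `(0, ∞)` of `(l + m x) 𝒰(x; p, q) - 2 x 𝒰(x; p, 1 + q)`. -/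
lemma moment_combination {p q : ℝ} (hp : -1 < p) (hpq : p + q < -1) (l m : ℝ) (n : ℕ) :
    IntegrableOn (fun x : ℝ => x ^ n *
        ((l + m * x) * modTricomiU x p q - 2 * x * modTricomiU x p (1 + q))) (Set.Ioi 0) ∧
      ∫ x in Set.Ioi (0 : ℝ), x ^ n *
          ((l + m * x) * modTricomiU x p q - 2 * x * modTricomiU x p (1 + q))
        = (Real.Gamma (1 + p))⁻¹ * ((l - (n + 1)) *
            (n.factorial * eulerIntegral (1 + p) q (n + 1)) +
          (m - 1) * ((n + 1).factorial * eulerIntegral (1 + p) q (n + 1 + 1))) := by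
  have h0 := moment_modTricomiU hp hpq n
  have h1 := moment_modTricomiU hp hpq (n + 1)
  have h2 := moment_mul_modTricomiU hp hpq n
  have heq : (fun x : ℝ => x ^ n *
        ((l + m * x) * modTricomiU x p q - 2 * x * modTricomiU x p (1 + q)))
      = fun x : ℝ => (l * (x ^ n * modTricomiU x p q) + m * (x ^ (n + 1) * modTricomiU x p q))
        - x ^ n * (2 * x * modTricomiU x p (1 + q)) := by
    funext x
    ring
  have h01 : IntegrableOn (fun x : ℝ => l * (x ^ n * modTricomiU x p q)
      + m * (x ^ (n + 1) * modTricomiU x p q)) (Set.Ioi 0) :=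
    (h0.1.const_mul l).add (h1.1.const_mul m)
  rw [heq]
  refine ⟨h01.sub h2.1, ?_⟩
  rw [integral_sub h01 h2.1, integral_add (h0.1.const_mul l) (h1.1.const_mul m),
    integral_const_mul, integral_const_mul, h0.2, h1.2, h2.2, Nat.factorial_succ]
  push_cast
  ring

/-! ### The normalising constant -/

lemma eulerIntegral_one_add {p q : ℝ} (hp : -1 < p) (hpq : p + q < -1) :
    eulerIntegral (1 + p) q 1 = Real.Gamma (1 + p) * Real.Gamma (-p - q) / Real.Gamma (1 - q) *
      ₂F₁ (1 : ℝ) (1 + p) (1 - q) (-1 : ℝ) := by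
  rw [eulerIntegral_one_eq (by linarith) (by linarith), show 1 - (1 + p) - q = -p - q by ring]

/-- This exhibits `Δ` as the total mass of the weight before normalisation. -/
lemma deltaConst_eq {p q : ℝ} (hp : -1 < p) (hq : -1 < q) (hpq : p + q < -1) :
    deltaConst p q
      = p * Real.Gamma (1 - q) * (Real.Gamma (1 + p))⁻¹ * eulerIntegral (1 + p) q 1
        + q * Real.Gamma (1 - p) * (Real.Gamma (1 + q))⁻¹ * eulerIntegral (1 + q) p 1 := by
  have h1 := (Real.Gamma_pos_of_pos (by linarith : 0 < 1 + p)).ne'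
  have h2 := (Real.Gamma_pos_of_pos (by linarith : 0 < 1 + q)).ne'
  have h3 := (Real.Gamma_pos_of_pos (by linarith : 0 < 1 - p)).ne'
  have h4 := (Real.Gamma_pos_of_pos (by linarith : 0 < 1 - q)).ne'
  rw [eulerIntegral_one_add hp hpq, eulerIntegral_one_add hq (by linarith), deltaConst,
    show -q - p = -p - q by ring]
  field_simp

lemma deltaConst_neg {p q : ℝ} (hp : -1 < p) (hp₀ : p < 0) (hq : -1 < q) (hq₀ : q < 0)
    (hpq : p + q < -1) : deltaConst p q < 0 := by
  rw [deltaConst_eq hp hq hpq]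
  have h1 := Real.Gamma_pos_of_pos (by linarith : 0 < 1 + p)
  have h2 := Real.Gamma_pos_of_pos (by linarith : 0 < 1 + q)
  have h3 := Real.Gamma_pos_of_pos (by linarith : 0 < 1 - p)
  have h4 := Real.Gamma_pos_of_pos (by linarith : 0 < 1 - q)
  have h5 := eulerIntegral_pos (a := 1 + p) (b := q) (σ := 1) (by linarith) (by linarith)
    (by linarith)
  have h6 := eulerIntegral_pos (a := 1 + q) (b := p) (σ := 1) (by linarith) (by linarith)
    (by linarith)
  have h7 : 0 < -p * Real.Gamma (1 - q) * (Real.Gamma (1 + p))⁻¹ * eulerIntegral (1 + p) q 1 := by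
    have : 0 < -p := neg_pos.2 hp₀
    positivity
  have h8 : 0 < -q * Real.Gamma (1 - p) * (Real.Gamma (1 + q))⁻¹ * eulerIntegral (1 + q) p 1 := by
    have : 0 < -q := neg_pos.2 hq₀
    positivity
  linarith

/-! ### Gluing the two half-lines -/

lemma exists_glue_continuousAt {g h : ℝ → ℝ} (h0 : g 0 = h 0)
    (hg : Tendsto g (𝓝[>] 0) (𝓝 (g 0))) (hh : Tendsto h (𝓝[<] 0) (𝓝 (h 0))) :
    ∃ w : ℝ → ℝ, (∀ x, 0 ≤ x → w x = g x) ∧ (∀ x, x ≤ 0 → w x = h x) ∧ ContinuousAt w 0 := by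
  classical
  have h1 (x : ℝ) (hx : 0 ≤ x) : (if 0 ≤ x then g x else h x) = g x := if_pos hx
  have h2 (x : ℝ) (hx : x ≤ 0) : (if 0 ≤ x then g x else h x) = h x := by
    rcases hx.lt_or_eq with hx | rfl
    · exact if_neg (not_le.2 hx)
    · rw [h1 0 le_rfl, h0]
  refine ⟨fun x => if 0 ≤ x then g x else h x, h1, h2, ?_⟩
  rw [continuousAt_iff_continuous_left'_right']
  refine ⟨?_, ?_⟩
  · rw [ContinuousWithinAt, h2 0 le_rfl]
    refine hh.congr' ?_
    filter_upwards [self_mem_nhdsWithin] with x hx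
    exact (h2 x (le_of_lt hx)).symm
  · rw [ContinuousWithinAt, h1 0 le_rfl]
    refine hg.congr' ?_
    filter_upwards [self_mem_nhdsWithin] with x hx
    exact (h1 x (le_of_lt hx)).symm

lemma tendsto_neg_nhdsLT_zero : Tendsto (fun x : ℝ => -x) (𝓝[<] 0) (𝓝[>] 0) := by
  simpa using tendsto_neg_nhdsLT (a := (0 : ℝ))

/-- The moment recurrence, with the contributions of the two half-lines. -/
lemma factorial_mul_eulerIntegral_recurrence {p q : ℝ} (hp : -1 < p) (hpq : p + q < -1) (n : ℕ) :
    (n + 2).factorial * eulerIntegral (1 + p) q (n + 2 + 1)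
      = (q - p) * ((n + 1).factorial * eulerIntegral (1 + p) q (n + 1 + 1))
        + (n + 1) * (n - (p + q)) * (n.factorial * eulerIntegral (1 + p) q (n + 1)) := by
  have hn : (0 : ℝ) ≤ n := n.cast_nonneg
  have h := eulerIntegral_recurrence (a := 1 + p) (b := q) (σ := n + 1) (by linarith)
    (by linarith) (by linarith) (by linarith)
  rw [show (n : ℝ) + 2 + 1 = n + 1 + 1 + 1 by ring, Nat.factorial_succ (n + 1), Nat.factorial_succ n]
  push_cast
  linear_combination ((n : ℝ) + 1) * n.factorial * h

theorem proposition4p2 (α₁ β₀ p q k₁ k₂ k₁' k₂' : ℝ)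
    (hp : p = -(1 / 2) * (α₁ + β₀)) (hq : q = -(1 / 2) * (α₁ - β₀))
    (hp₁ : -1 < p) (hp₀ : p < 0) (hq₁ : -1 < q) (hq₀ : q < 0)
    (hpq₂ : -2 < p + q) (hpq₁ : p + q < -1)
    (hk₁ : k₁ = p * Real.Gamma (1 - q) / deltaConst p q)
    (hk₂ : k₂ = q * Real.Gamma (1 - p) / deltaConst p q)
    (hk₁' : k₁' = -(q * Real.Gamma (-q)) / (2 * deltaConst p q))
    (hk₂' : k₂' = -(q * Real.Gamma (-p)) / (2 * deltaConst p q))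
    (u : ℕ → Module.Dual ℂ ℂ[X])
    (hu : IsDualSequence (twoOPS (-1) 0 β₀ α₁ (β₀ - α₁)) u) :
    deltaConst p q ≠ 0 ∧
    ∃ w₀ w₁ : ℝ → ℝ,
      (∀ x : ℝ, 0 ≤ x → w₀ x = k₁ * modTricomiU x p q) ∧
      (∀ x : ℝ, x ≤ 0 → w₀ x = k₂ * modTricomiV x q p) ∧
      (∀ x : ℝ, 0 ≤ x →
        w₁ x = k₁' * ((1 + β₀) * modTricomiU x p q - 2 * x * modTricomiU x p (1 + q))) ∧
      (∀ x : ℝ, x ≤ 0 →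
        w₁ x = k₂' * ((1 + β₀ - 2 * x) * modTricomiV x q p
          + 2 * x * modTricomiV x q (1 + p))) ∧
      ContinuousAt w₀ 0 ∧ ContinuousAt w₁ 0 ∧
      HasIntegralRepresentation (u 0) w₀ ∧
      HasIntegralRepresentation (u 1) w₁ := by
  obtain rfl : α₁ = -(p + q) := by linarith
  obtain rfl : β₀ = q - p := by linarith
  rw [show q - p - -(p + q) = 2 * q by ring] at hu
  have hΔ : deltaConst p q ≠ 0 := (deltaConst_neg hp₁ hp₀ hq₁ hq₀ hpq₁).ne
  have hqp : q + p < -1 := by linarith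
  have hGp : Real.Gamma (-p) ≠ 0 := (Real.Gamma_pos_of_pos (by linarith)).ne'
  have hGq : Real.Gamma (-q) ≠ 0 := (Real.Gamma_pos_of_pos (by linarith)).ne'
  have hG1p : Real.Gamma (1 - p) = -p * Real.Gamma (-p) := by
    rw [← Real.Gamma_add_one (by linarith), neg_add_eq_sub]
  have hG1q : Real.Gamma (1 - q) = -q * Real.Gamma (-q) := by
    rw [← Real.Gamma_add_one (by linarith), neg_add_eq_sub]
  -- Both constants of `w₁` are those of `w₀` over `2p`, the factor in the moment formula for `u 1`.
  have hk1 : k₁' = k₁ / (2 * p) := by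
    have := hp₀.ne
    rw [hk₁', hk₁, hG1q]
    field_simp
  have hk2 : k₂' = k₂ / (2 * p) := by
    have := hp₀.ne
    rw [hk₂', hk₂, hG1p]
    field_simp
  -- Both sides equal `-p q Γ(-1-p-q) / Δ`.
  have h0 : k₁ * modTricomiU 0 p q = k₂ * modTricomiU 0 q p := by
    rw [modTricomiU_zero_eq hp₁ hpq₁, modTricomiU_zero_eq hq₁ hqp, hk₁, hk₂, hG1p, hG1q,
      show -1 - q - p = -1 - p - q by ring]
    field_simp
  have hU := tendsto_modTricomiU_zero hp₁ hpq₁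
  have hV : Tendsto (fun x => modTricomiV x q p) (𝓝[<] 0) (𝓝 (modTricomiV 0 q p)) := by
    simp only [modTricomiV_eq, neg_zero]
    exact (tendsto_modTricomiU_zero hq₁ hqp).comp tendsto_neg_nhdsLT_zero
  have hU' := tendsto_mul_modTricomiU_zero hp₁ hpq₁
  have hV' : Tendsto (fun x => 2 * x * modTricomiV x q (1 + p)) (𝓝[<] 0) (𝓝 0) := by
    have := ((tendsto_mul_modTricomiU_zero hq₁ hqp).comp tendsto_neg_nhdsLT_zero).neg
    rw [neg_zero] at this
    refine this.congr fun x => ?_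
    rw [modTricomiV_eq, Function.comp_apply]
    ring
  obtain ⟨w₀, hw0R, hw0L, hw0c⟩ := exists_glue_continuousAt
    (g := fun x => k₁ * modTricomiU x p q) (h := fun x => k₂ * modTricomiV x q p)
    (by simpa [modTricomiV_eq] using h0) (hU.const_mul k₁) (hV.const_mul k₂)
  obtain ⟨w₁, hw1R, hw1L, hw1c⟩ := exists_glue_continuousAt
    (g := fun x => k₁' * ((1 + (q - p)) * modTricomiU x p q - 2 * x * modTricomiU x p (1 + q)))
    (h := fun x => k₂' * ((1 + (q - p) - 2 * x) * modTricomiV x q p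
          + 2 * x * modTricomiV x q (1 + p)))
    (by
      simp only [modTricomiV_eq, neg_zero, hk1, hk2]
      linear_combination (1 + (q - p)) / (2 * p) * h0)
    (by simpa using ((hU.const_mul (1 + (q - p))).sub hU').const_mul k₁')
    (by
      have hlin : Tendsto (fun x : ℝ => 1 + (q - p) - 2 * x) (𝓝[<] 0)
          (𝓝 (1 + (q - p) - 2 * 0)) :=
        (Continuous.tendsto (by fun_prop) 0).mono_left nhdsWithin_le_nhds
      simpa using ((hlin.mul hV).add hV').const_mul k₂')
  refine ⟨hΔ, w₀, w₁, hw0R, hw0L, hw1R, hw1L, hw0c, hw1c, ?_⟩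
  set R : ℕ → ℝ := fun n => k₁ * ((Real.Gamma (1 + p))⁻¹ *
    (n.factorial * eulerIntegral (1 + p) q (n + 1))) with hR
  set L : ℕ → ℝ := fun n => k₂ * ((Real.Gamma (1 + q))⁻¹ *
    (n.factorial * eulerIntegral (1 + q) p (n + 1))) with hL
  set M : ℕ → ℝ := fun n => R n + (-1) ^ n * L n with hM
  have m0 (n : ℕ) : Integrable (fun x : ℝ => x ^ n * w₀ x) ∧ ∫ x : ℝ, x ^ n * w₀ x = M n := by
    have hr := moment_modTricomiU hp₁ hpq₁ n
    have hl := moment_modTricomiU hq₁ hqp n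
    have er : Set.EqOn (fun x : ℝ => k₁ * (x ^ n * modTricomiU x p q))
        (fun x => x ^ n * w₀ x) (Set.Ioi 0) := fun x hx => by
      simp only [hw0R x (le_of_lt hx)]
      ring
    have el : Set.EqOn (fun x : ℝ => k₂ * (x ^ n * modTricomiU x q p))
        (fun x => x ^ n * w₀ (-x)) (Set.Ioi 0) := fun x hx => by
      simp only [hw0L (-x) (neg_nonpos.2 (le_of_lt hx)), modTricomiV_eq, neg_neg]
      ring
    refine integral_pow_mul_of_halves
      (IntegrableOn.congr_fun (hr.1.const_mul _) er measurableSet_Ioi) ?_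
      (IntegrableOn.congr_fun (hl.1.const_mul _) el measurableSet_Ioi) ?_
    · rw [← setIntegral_congr_fun measurableSet_Ioi er, integral_const_mul, hr.2]
    · rw [← setIntegral_congr_fun measurableSet_Ioi el, integral_const_mul, hl.2]
  have m1 (n : ℕ) : Integrable (fun x : ℝ => x ^ n * w₁ x) ∧
      ∫ x : ℝ, x ^ n * w₁ x = 1 / (2 * p) * ((q - p - n) * M n - M (n + 1)) := by
    -- The slopes `0` and `2` make the coefficient `m - 1` of the next moment `-1` on the right and
    -- `+1` on the left, where `(-1)^n = -(-1)^{n+1}` restores the common sign.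
    have hr := moment_combination hp₁ hpq₁ (1 + (q - p)) 0 n
    have hl := moment_combination hq₁ hqp (1 + (q - p)) 2 n
    have er : Set.EqOn (fun x : ℝ => k₁' * (x ^ n * ((1 + (q - p) + 0 * x) * modTricomiU x p q
        - 2 * x * modTricomiU x p (1 + q)))) (fun x => x ^ n * w₁ x) (Set.Ioi 0) := fun x hx => by
      simp only [hw1R x (le_of_lt hx)]
      ring
    have el : Set.EqOn (fun x : ℝ => k₂' * (x ^ n * ((1 + (q - p) + 2 * x) * modTricomiU x q p
        - 2 * x * modTricomiU x q (1 + p)))) (fun x => x ^ n * w₁ (-x)) (Set.Ioi 0) :=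
      fun x hx => by
        simp only [hw1L (-x) (neg_nonpos.2 (le_of_lt hx)), modTricomiV_eq, neg_neg]
        ring
    have key := integral_pow_mul_of_halves
      (IntegrableOn.congr_fun (hr.1.const_mul _) er measurableSet_Ioi) rfl
      (IntegrableOn.congr_fun (hl.1.const_mul _) el measurableSet_Ioi) rfl
    refine ⟨key.1, ?_⟩
    rw [key.2, ← setIntegral_congr_fun measurableSet_Ioi er,
      ← setIntegral_congr_fun measurableSet_Ioi el, integral_const_mul, integral_const_mul,
      hr.2, hl.2, hk1, hk2]
    simp only [hM, hR, hL]
    push_cast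
    ring
  have hM0 : M 0 = 1 := by
    simp only [hM, hR, hL, hk₁, hk₂, pow_zero, Nat.factorial_zero, Nat.cast_zero, Nat.cast_one,
      zero_add, one_mul]
    have := deltaConst_eq hp₁ hq₁ hpq₁
    rw [div_mul_eq_mul_div, div_mul_eq_mul_div, ← add_div, div_eq_one_iff_eq hΔ, this]
    ring
  have hM1 : M 1 = (q - p) * M 0 := by
    -- At `σ = 0` the first term is a multiple of the value at `0` of the Tricomi integral; the two
    -- such terms cancel by `h0`.
    have hr := eulerIntegral_recurrence (a := 1 + p) (b := q) (σ := 0) (by linarith) le_rfl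
      (by linarith) (by linarith)
    have hl := eulerIntegral_recurrence (a := 1 + q) (b := p) (σ := 0) (by linarith) le_rfl
      (by linarith) (by linarith)
    rw [modTricomiU_zero hp₁ hpq₁, modTricomiU_zero hq₁ hqp, ← eulerIntegral_zero,
      ← eulerIntegral_zero] at h0
    simp only [zero_add, one_mul, sub_zero] at hr hl
    simp only [hM, hR, hL, pow_zero, pow_one, Nat.factorial_zero, Nat.factorial_one,
      Nat.cast_zero, Nat.cast_one, zero_add, one_mul]
    linear_combination k₁ * (Real.Gamma (1 + p))⁻¹ * hr - k₂ * (Real.Gamma (1 + q))⁻¹ * hl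
      - (1 + p + q) * h0
  have hM2 (n : ℕ) : M (n + 2) = (q - p) * M (n + 1) + (n + 1) * (n - (p + q)) * M n := by
    have hr := factorial_mul_eulerIntegral_recurrence hp₁ hpq₁ n
    have hl := factorial_mul_eulerIntegral_recurrence hq₁ hqp n
    simp only [hM, hR, hL]
    push_cast
    -- Exchanging `p` and `q` flips the sign of `q - p`, which `(-1)^{n+1} = -(-1)^n` compensates.
    linear_combination k₁ * (Real.Gamma (1 + p))⁻¹ * hr
      + (-1) ^ n * k₂ * (Real.Gamma (1 + q))⁻¹ * hl
  have hdual := dualSequence_moments p q hp₀.ne (fun n => (M n : ℂ)) (by exact_mod_cast hM0)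
    (by exact_mod_cast hM1) (fun n => by exact_mod_cast hM2 n) hu
  exact ⟨hasIntegralRepresentation_of_moments (fun n => (m0 n).1) (fun n => (m0 n).2)
      (fun n => (hdual n).1),
    hasIntegralRepresentation_of_moments (fun n => (m1 n).1) (fun n => (m1 n).2)
      (fun n => by rw [(hdual n).2]; push_cast; rfl)⟩
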